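/- For every real $C$ and every $\beta>0$ there is a constant $\gamma=\gamma(\beta,C)>0$, depending only on $\beta$ and $C$, such that the following holds. Let $\mathbb{K}$ be $\mathbb{R}$ or $\mathbb{C}$, let $(\Omega,\mu)$ be a probability space, and let $\phi_1,\dots,\phi_n:\Omega\to\mathbb{K}$ be measurable functions (not necessarily bounded or orthogonal) with $\|\phi_j\|_{L^2(\mu)}=1$ that satisfy the $\psi_2(C)$ condition $$\Big\|\sum_{j=1}^n a_j\phi_j\Big\|_{\psi_2}\le C\Big(\sum_{j=1}^n|a_j|^2\Big)^{1/2}\qquad\text{for all } a_1,\dots,a_n\in\mathbb{K},$$ where $\|f\|_{\psi_2}=\inf\{K>0:\int_\Omega (e^{|f|^2/K^2}-1)\,d\mu\le 1\}$ is the Orlicz norm associated to $\psi_2(x)=e^{|x|^2}-1$. Let $x_1,\dots,x_n$ be vectors in a normed space over $\mathbb{K}$ with $\|x_j\|\le 1$, let $\lambda_1,\dots,\lambda_n\in\mathbb{K}$, and let $r_1,\dots,r_n$ be independent Rademacher functions (taking the values $\pm1$ with probability $1/2$ each) on a probability space $(\Omega',P)$. If $$\int_\Omega\Big\|\sum_{j=1}^n|\lambda_j|\,\phi_j(\omega)\,x_j\Big\|\,d\mu(\omega)\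 \ge\ \beta\sum_{j=1}^n|\lambda_j|,$$ then $$\int_{\Omega'}\Big\|\sum_{j=1}^n\lambda_j\,r_j(\omega)\,x_j\Big\|\,dP(\omega)\ \ge\ \gamma\sum_{j=1}^n|\lambda_j|.$$ -/

import Mathlib

open MeasureTheory ProbabilityTheory
open scoped ENNReal NNReal

/-- The Orlicz (Luxemburg) norm of `f` with respect to `Φ`: the infimum of all `K > 0` such that
`∫ Φ(|f| / K) dμ ≤ 1`, with the value `∞` when there is no such `K`. -/
noncomputable def orliczNorm {Ω E : Type*} [MeasurableSpace Ω] [Norm E] (Φ : ℝ → ℝ)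
    (f : Ω → E) (μ : Measure Ω) : ℝ≥0∞ :=
  ⨅ (K : ℝ≥0) (_ : 0 < K) (_ : ∫⁻ ω, ENNReal.ofReal (Φ (‖f ω‖ / K)) ∂μ ≤ 1), (K : ℝ≥0∞)

/-- The Young function `ψ₂(x) = exp(|x|²) - 1`. -/
noncomputable def psi2 (x : ℝ) : ℝ := Real.exp (|x| ^ 2) - 1

/-- The `ψ₂(C)` condition for a finite system `φ`: for all scalars `a`,
`‖∑ aⱼ φⱼ‖_{ψ₂} ≤ C (∑ |aⱼ|²)^{1/2}`. -/
def Psi2Condition {Ω 𝕜 ι : Type*} [MeasurableSpace Ω] [RCLike 𝕜] [Fintype ι] (C : ℝ)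
    (φ : ι → Ω → 𝕜) (μ : Measure Ω) : Prop :=
  ∀ a : ι → 𝕜, orliczNorm psi2 (fun ω => ∑ j, a j * φ j ω) μ ≤
    ENNReal.ofReal (C * Real.sqrt (∑ j, ‖a j‖ ^ 2))

/-- A system of independent Rademacher functions: independent measurable functions taking each of
the values `1` and `-1` with probability `1/2`. -/
structure IsRademacherSystem {Ω ι : Type*} [MeasurableSpace Ω] (r : ι → Ω → ℝ)
    (P : Measure Ω) : Prop where
  measurable : ∀ j, Measurable (r j)
  prob_one : ∀ j, P {ω | r j ω = 1} = 1 / 2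
  prob_neg_one : ∀ j, P {ω | r j ω = -1} = 1 / 2
  indep : iIndepFun r P

open scoped BigOperators

/-! The engine is a one-sided comparison with an arbitrarily small loss: for nonnegative weights of
total mass S and a real subgaussian system, E‖∑ λⱼφⱼxⱼ‖ ≤ A·R + εS, where R = E‖∑ λⱼεⱼxⱼ‖ and A
depends only on ε and the subgaussian constant (`exists_majorant_norm`). The theorem follows with ε
= β/4, applied to the real and the imaginary part after the phases of λⱼ have been absorbed into the
vectors.

For the comparison, the norm is replaced by a maximum over a finite T ⊆ [-1,1]^ι of functional
values. The few weights above τS are controlled by R one at a time. Sorting the other weights into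
geometric levels and discarding a residue class of levels of mass at most S/q leaves blocks of
comparable weights, separated by gaps (`exists_lacunary_decomposition`).

The blocks are then revealed from large weights to small ones. `tailMean` k t is the mean maximum of
the signed sum over blocks ≥ k among the points of T that agree with t, up to mesh 1/m, on the
earlier blocks. Its drops along k telescope to the full Rademacher maximum. At each block there is a
dichotomy. If the drop at t is large, A times it pays for the block outright. If it is small, t lies
in a set with small Rademacher average on that block; a Sudakov minoration for signs
(`sudakov_signs`) gives that set a small net, and the ψ₂ union bound over the nets of all cells
(`exists_majorant`) is cheap, since the gaps make the earlier coordinates few compared with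
1/(weight in this block).

The Sudakov bound is proved with Gibbs measures: flipping one sign tilts the measure, and the
resulting shift of a mean dominates a variance. -/

/-- The maximum of `f` over a finite set, with the value `0` on the empty set. -/
noncomputable def finsetMax {α : Type*} (s : Finset α) (f : α → ℝ) : ℝ :=
  if h : s.Nonempty then s.sup' h f else 0

theorem le_finsetMax {α : Type*} {s : Finset α} {a : α} (h : a ∈ s) (f : α → ℝ) : f a ≤ finsetMax s f := by
  rw [finsetMax, dif_pos ⟨a, h⟩]
  exact Finset.le_sup' f h

theorem exists_mem_eq_finsetMax {α : Type*} {s : Finset α} (h : s.Nonempty) (f : α → ℝ) :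
    ∃ a ∈ s, finsetMax s f = f a := by
  rw [finsetMax, dif_pos h]
  exact Finset.exists_mem_eq_sup' h f

theorem finsetMax_le {α : Type*} {s : Finset α} (h : s.Nonempty) {f : α → ℝ} {c : ℝ}
    (hc : ∀ a ∈ s, f a ≤ c) : finsetMax s f ≤ c := by
  obtain ⟨a, ha, e⟩ := exists_mem_eq_finsetMax h f
  exact e ▸ hc a ha

/-- The sign attached to a Boolean. -/
def boolSign (b : Bool) : ℝ := if b then 1 else -1

theorem boolSign_not (b : Bool) : boolSign (!b) = -boolSign b := by
  cases b <;> simp [boolSign]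

theorem boolSign_mul_self (b : Bool) : boolSign b * boolSign b = 1 := by
  cases b <;> simp [boolSign]

theorem abs_boolSign (b : Bool) : |boolSign b| = 1 := by
  cases b <;> simp [boolSign]

/-! ### Gibbs measures on a finite set. -/

section Gibbs

variable {κ : Type*} [Fintype κ] [Nonempty κ]

/-- Tilting a finite Gibbs measure by `exp (-2 x)` lowers the mean of `x` by at least a constant
times its variance. -/
theorem gibbs_shift (w x : κ → ℝ) (hw : ∀ i, 0 < w i) (hx : ∀ i, |x i| ≤ 1) :
    Real.exp (-4) * ((∑ i, ∑ k, w i * w k * (x i - x k) ^ 2) / (∑ i, w i) ^ 2) ≤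
      (∑ i, w i * x i) / (∑ i, w i) -
        (∑ i, w i * Real.exp (-2 * x i) * x i) / (∑ i, w i * Real.exp (-2 * x i)) := by
  set v : κ → ℝ := fun i => w i * Real.exp (-2 * x i) with hv
  have hv0 : ∀ i, 0 < v i := fun i => mul_pos (hw i) (Real.exp_pos _)
  set W := ∑ i, w i with hW
  set V := ∑ i, v i with hV
  have hW0 : 0 < W := Finset.sum_pos (fun i _ => hw i) Finset.univ_nonempty
  have hV0 : 0 < V := Finset.sum_pos (fun i _ => hv0 i) Finset.univ_nonempty
  have hVW : V ≤ Real.exp 2 * W := by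
    rw [hV, hW, Finset.mul_sum]
    refine Finset.sum_le_sum fun i _ => ?_
    rw [mul_comm (Real.exp 2)]
    refine mul_le_mul_of_nonneg_left (Real.exp_le_exp.2 ?_) (hw i).le
    linarith [(abs_le.1 (hx i)).1]
  set Q := ∑ i, ∑ k, w i * w k * (x i - x k) ^ 2 with hQ
  have hQ0 : 0 ≤ Q := Finset.sum_nonneg fun i _ => Finset.sum_nonneg fun k _ =>
    mul_nonneg (mul_nonneg (hw i).le (hw k).le) (sq_nonneg _)
  have key : ∀ a b : ℝ, |a| ≤ 1 → |b| ≤ 1 →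
      2 * Real.exp (-2) * (a - b) ^ 2 ≤ (Real.exp (-2 * b) - Real.exp (-2 * a)) * (a - b) := by
    have h1 : ∀ a b : ℝ, |a| ≤ 1 → b ≤ a →
        2 * Real.exp (-2) * (a - b) ^ 2 ≤ (Real.exp (-2 * b) - Real.exp (-2 * a)) * (a - b) := by
      intro a b ha hab
      have e1 : Real.exp (-2 * b) = Real.exp (-2 * a) * Real.exp (2 * (a - b)) := by
        rw [← Real.exp_add]; congr 1; ring
      have e2 := Real.add_one_le_exp (2 * (a - b))
      have e3 : Real.exp (-2) ≤ Real.exp (-2 * a) :=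
        Real.exp_le_exp.2 (by linarith [(abs_le.1 ha).2])
      have e4 : 2 * Real.exp (-2) * (a - b) ≤ Real.exp (-2 * b) - Real.exp (-2 * a) := by
        rw [e1]
        nlinarith [Real.exp_pos (-2 * a), mul_le_mul_of_nonneg_right e3 (sub_nonneg.2 hab),
          mul_le_mul_of_nonneg_left e2 (Real.exp_pos (-2 * a)).le]
      calc 2 * Real.exp (-2) * (a - b) ^ 2 = 2 * Real.exp (-2) * (a - b) * (a - b) := by ring
        _ ≤ _ := mul_le_mul_of_nonneg_right e4 (sub_nonneg.2 hab)
    intro a b ha hb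
    rcases le_total b a with h | h
    · exact h1 a b ha h
    · have := h1 b a hb h
      nlinarith [this]
  have hN : (∑ i, w i * x i) * V - (∑ i, v i * x i) * W =
      ∑ i, ∑ k, w i * v k * (x i - x k) := by
    have e1 : (∑ i, w i * x i) * V = ∑ i, ∑ k, w i * v k * x i := by
      rw [hV, Finset.sum_mul_sum]
      exact Finset.sum_congr rfl fun i _ => Finset.sum_congr rfl fun k _ => by ring
    have e2 : (∑ i, v i * x i) * W = ∑ i, ∑ k, w i * v k * x k := by
      rw [hW, Finset.sum_mul_sum, Finset.sum_comm]
      exact Finset.sum_congr rfl fun i _ => Finset.sum_congr rfl fun k _ => by ring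
    rw [e1, e2, ← Finset.sum_sub_distrib]
    refine Finset.sum_congr rfl fun i _ => ?_
    rw [← Finset.sum_sub_distrib]
    exact Finset.sum_congr rfl fun k _ => by ring
  -- Adding the copy with i and k exchanged turns the summand into w i * w k * (exp(-2 x k) - exp(-2
  -- x i)) * (x i - x k), to which `key` applies.
  have hN2 : Real.exp (-2) * Q ≤ ∑ i, ∑ k, w i * v k * (x i - x k) := by
    have e1 : ∑ i, ∑ k, w i * v k * (x i - x k) = ∑ i, ∑ k, w k * v i * (x k - x i) :=
      Finset.sum_comm
    have e2 : 2 * (Real.exp (-2) * Q) ≤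
        ∑ i, ∑ k, w i * v k * (x i - x k) + ∑ i, ∑ k, w k * v i * (x k - x i) := by
      rw [hQ, ← mul_assoc, Finset.mul_sum, ← Finset.sum_add_distrib]
      refine Finset.sum_le_sum fun i _ => ?_
      rw [Finset.mul_sum, ← Finset.sum_add_distrib]
      refine Finset.sum_le_sum fun k _ => ?_
      have := mul_le_mul_of_nonneg_left (key (x i) (x k) (hx i) (hx k))
        (mul_nonneg (hw i).le (hw k).le)
      simp only [hv]
      nlinarith [this]
    linarith
  -- The slope of the exponential costs e⁻², and V ≤ e²W costs another e⁻².
  have e4 : Real.exp (-4) * Real.exp 2 = Real.exp (-2) := by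
    rw [← Real.exp_add]; norm_num
  have hfin : Real.exp (-4) * (Q / W ^ 2) ≤ (∑ i, ∑ k, w i * v k * (x i - x k)) / (W * V) := by
    rw [← mul_div_assoc, div_le_div_iff₀ (by positivity) (by positivity)]
    calc Real.exp (-4) * Q * (W * V) ≤ Real.exp (-4) * Q * (W * (Real.exp 2 * W)) := by gcongr
      _ = (Real.exp (-2) * Q) * W ^ 2 := by rw [← e4]; ring
      _ ≤ _ := mul_le_mul_of_nonneg_right hN2 (by positivity)
  refine hfin.trans (le_of_eq ?_)
  rw [← hN, sub_div, mul_div_mul_right _ _ hV0.ne', mul_comm W V, mul_div_mul_right _ _ hW0.ne']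

/-- Jensen for the exponential, obtained by summing 1 + u ≤ exp u at u = E i - log Z + log N, with N
the number of points. -/
theorem log_sum_exp_ge (E : κ → ℝ) :
    Real.log (Fintype.card κ) + (∑ i, E i) / Fintype.card κ ≤ Real.log (∑ i, Real.exp (E i)) := by
  have hN : (0 : ℝ) < Fintype.card κ := by exact_mod_cast Fintype.card_pos
  set Z := ∑ i, Real.exp (E i) with hZ
  have hZ0 : 0 < Z := Finset.sum_pos (fun i _ => Real.exp_pos _) Finset.univ_nonempty
  have h : ∑ i, (E i - Real.log Z + Real.log (Fintype.card κ) + 1) ≤ Fintype.card κ := by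
    calc _ ≤ ∑ i, Real.exp (E i - Real.log Z + Real.log (Fintype.card κ)) :=
          Finset.sum_le_sum fun i _ => Real.add_one_le_exp _
      _ = ∑ i, Real.exp (E i) * (Fintype.card κ / Z) := by
          refine Finset.sum_congr rfl fun i _ => ?_
          rw [Real.exp_add, Real.exp_sub, Real.exp_log hZ0, Real.exp_log hN]; ring
      _ = _ := by rw [← Finset.sum_mul, ← hZ]; field_simp
  simp only [Finset.sum_add_distrib, Finset.sum_sub_distrib, Finset.sum_const, Finset.card_univ,
    nsmul_eq_mul, mul_one] at h
  have : (∑ i, E i) / Fintype.card κ ≤ Real.log Z - Real.log (Fintype.card κ) := by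
    rw [div_le_iff₀ hN]; nlinarith
  linarith

/-- The largest Gibbs weight, bounded through its logarithm. -/
theorem exp_neg_le_of_le_log {N y : ℝ} (hN : 2 ≤ N) (hy0 : 0 ≤ y) (hy : y ≤ Real.log N) :
    Real.exp (-y) ≤ 1 - (1 / 2) * (y / Real.log N) := by
  have hl : 0 < Real.log N := Real.log_pos (by linarith)
  set u := y / Real.log N with hu
  have hu0 : 0 ≤ u := by positivity
  have hu1 : u ≤ 1 := (div_le_one hl).2 hy
  -- The chord of exp between -log N and 0; its left value 1/N is at most 1/2 because N ≥ 2.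
  have hc := convexOn_exp.2 (Set.mem_univ (-Real.log N)) (Set.mem_univ 0) hu0
    (sub_nonneg.2 hu1) (by ring)
  have e : u • (-Real.log N) + (1 - u) • (0 : ℝ) = -y := by
    simp only [smul_eq_mul, mul_zero, add_zero, hu]; field_simp
  rw [e, Real.exp_neg (Real.log N), Real.exp_log (by linarith), Real.exp_zero] at hc
  have : N⁻¹ ≤ 1 / 2 := by rw [inv_le_comm₀ (by linarith) (by norm_num)]; norm_num; exact hN
  simp only [smul_eq_mul] at hc
  nlinarith

end Gibbs

/-! ### Averages over the cube of signs. -/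

section Signs

variable {ι : Type*} [DecidableEq ι]

/-- Flip the sign of the coordinate `j`. -/
def flipAt (j : ι) : (ι → Bool) ≃ (ι → Bool) :=
  Equiv.piCongrRight fun i => if i = j then Equiv.boolNot else Equiv.refl _

theorem flipAt_same (j : ι) (ε : ι → Bool) : flipAt j ε j = !ε j := by
  simp [flipAt]

theorem flipAt_of_ne {i j : ι} (h : i ≠ j) (ε : ι → Bool) : flipAt j ε i = ε i := by
  simp [flipAt, h]

variable [Fintype ι]

theorem expect_neg_signs (F : (ι → Bool) → ℝ) : 𝔼 ε : ι → Bool, F (fun j => !ε j) = 𝔼 ε, F ε := by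
  refine Fintype.expect_equiv (Equiv.piCongrRight fun _ => Equiv.boolNot) _ _ fun ε => ?_
  rfl

theorem expect_signed_sum_eq_zero (s : Finset ι) (c : ι → ℝ) :
    𝔼 ε : ι → Bool, ∑ j ∈ s, c j * boolSign (ε j) = 0 := by
  have h := expect_neg_signs (fun ε : ι → Bool => ∑ j ∈ s, c j * boolSign (ε j))
  simp only [boolSign_not, mul_neg, Finset.sum_neg_distrib, Finset.expect_neg_distrib] at h
  linarith

/-- Discrete integration by parts: flipping coordinate j permutes the cube and reverses its sign, so
only the dependence of F on that coordinate survives. -/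
theorem expect_boolSign_mul (j : ι) (F : (ι → Bool) → ℝ) :
    𝔼 ε, boolSign (ε j) * F ε = (1 / 2) * 𝔼 ε, boolSign (ε j) * (F ε - F (flipAt j ε)) := by
  have h : 𝔼 ε, boolSign (flipAt j ε j) * F (flipAt j ε) = 𝔼 ε, boolSign (ε j) * F ε :=
    Fintype.expect_equiv (flipAt j) _ _ fun ε => rfl
  simp only [flipAt_same, boolSign_not, neg_mul, Finset.expect_neg_distrib] at h
  simp only [mul_sub, Finset.expect_sub_distrib]
  linarith

/-- Replacing the signs on a set of coordinates by independent copies. -/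
theorem expect_mix (p : ι → Prop) [DecidablePred p] (F : (ι → Bool) → ℝ) :
    𝔼 ε : ι → Bool, 𝔼 ε' : ι → Bool, F (fun j => if p j then ε j else ε' j) = 𝔼 ε, F ε := by
  -- Exchanging two independent copies at the coordinates where p fails is an involution of the
  -- pairs.
  let e : (ι → Bool) × (ι → Bool) ≃ (ι → Bool) × (ι → Bool) :=
    { toFun := fun q => (fun j => if p j then q.1 j else q.2 j,
        fun j => if p j then q.2 j else q.1 j)
      invFun := fun q => (fun j => if p j then q.1 j else q.2 j,
        fun j => if p j then q.2 j else q.1 j)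
      left_inv := fun q => by
        ext j <;> by_cases h : p j <;> simp [h]
      right_inv := fun q => by
        ext j <;> by_cases h : p j <;> simp [h] }
  have h1 : 𝔼 ε : ι → Bool, 𝔼 ε' : ι → Bool, F (fun j => if p j then ε j else ε' j) =
      𝔼 q : (ι → Bool) × (ι → Bool), F (e q).1 := by
    rw [← Finset.univ_product_univ, Finset.expect_product]
    rfl
  have h2 : 𝔼 q : (ι → Bool) × (ι → Bool), F (e q).1 =
      𝔼 q : (ι → Bool) × (ι → Bool), F q.1 := Fintype.expect_equiv e _ _ fun q => rfl
  rw [h1, h2, ← Finset.univ_product_univ, Finset.expect_product]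
  simp

end Signs

/-! ### Sudakov minoration for signs. -/

section Sudakov

variable {ι κ : Type*} [Fintype ι] [DecidableEq ι] [Fintype κ] [Nonempty κ]

/-- After integration by parts in ε j, the flip multiplies the Gibbs weights by exp(-2 x i) with x i
= a j ε j t i j, and `gibbs_shift` bounds the change of mean below by a variance. The bounds on a
and t serve to give |x i| ≤ 1. -/
theorem expect_gibbs_mean_ge (a : ι → ℝ) (t : κ → ι → ℝ) (ha0 : ∀ j, 0 ≤ a j)
    (ha1 : ∀ j, a j ≤ 1) (ht : ∀ i j, |t i j| ≤ 1) (w : (ι → Bool) → κ → ℝ)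
    (hw : w = fun ε i => Real.exp (∑ j, a j * boolSign (ε j) * t i j)) (j : ι) :
    (1 / 2) * Real.exp (-4) * 𝔼 ε, (∑ i, ∑ k, w ε i * w ε k * (a j ^ 2 * (t i j - t k j) ^ 2)) /
        (∑ i, w ε i) ^ 2 ≤
      𝔼 ε, a j * boolSign (ε j) * ((∑ i, w ε i * t i j) / ∑ i, w ε i) := by
  have hw0 : ∀ ε i, 0 < w ε i := fun ε i => by rw [hw]; exact Real.exp_pos _
  have h1 : 𝔼 ε, a j * boolSign (ε j) * ((∑ i, w ε i * t i j) / ∑ i, w ε i) =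
      𝔼 ε, boolSign (ε j) * (a j * ((∑ i, w ε i * t i j) / ∑ i, w ε i)) :=
    Finset.expect_congr rfl fun ε _ => by ring
  rw [h1, expect_boolSign_mul, mul_assoc, Finset.mul_expect]
  refine mul_le_mul_of_nonneg_left (Finset.expect_le_expect fun ε _ => ?_) (by norm_num)
  have hflip : ∀ i, w (flipAt j ε) i =
      w ε i * Real.exp (-2 * (a j * boolSign (ε j) * t i j)) := by
    intro i
    rw [hw]
    simp only
    rw [← Real.exp_add]
    congr 1
    rw [← Finset.add_sum_erase _ _ (Finset.mem_univ j),
      ← Finset.add_sum_erase (a := j) Finset.univ (fun j => a j * boolSign (ε j) * t i j)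
        (Finset.mem_univ j), flipAt_same, boolSign_not]
    have : ∑ x ∈ Finset.univ.erase j, a x * boolSign (flipAt j ε x) * t i x =
        ∑ x ∈ Finset.univ.erase j, a x * boolSign (ε x) * t i x :=
      Finset.sum_congr rfl fun x hx => by rw [flipAt_of_ne (Finset.ne_of_mem_erase hx)]
    rw [this]; ring
  have hx : ∀ i, |a j * boolSign (ε j) * t i j| ≤ 1 := fun i => by
    rw [abs_mul, abs_mul, abs_boolSign, mul_one, abs_of_nonneg (ha0 j)]
    exact mul_le_one₀ (ha1 j) (abs_nonneg _) (ht i j)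
  have hg := gibbs_shift (w ε) (fun i => a j * boolSign (ε j) * t i j) (hw0 ε) hx
  have hs := boolSign_mul_self (ε j)
  have e1 : ∀ i k, (a j * boolSign (ε j) * t i j - a j * boolSign (ε j) * t k j) ^ 2 =
      a j ^ 2 * (t i j - t k j) ^ 2 := fun i k => by
    calc _ = a j ^ 2 * (t i j - t k j) ^ 2 * (boolSign (ε j) * boolSign (ε j)) := by ring
      _ = _ := by rw [hs, mul_one]
  simp only [e1, ← hflip] at hg
  refine hg.trans (le_of_eq ?_)
  have e2 : ∀ v : κ → ℝ, ∑ i, v i * (a j * boolSign (ε j) * t i j) =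
      a j * boolSign (ε j) * ∑ i, v i * t i j := fun v => by
    rw [Finset.mul_sum]; exact Finset.sum_congr rfl fun i _ => by ring
  rw [e2, e2]; ring

/-- A weak form of Sudakov's minoration for Rademacher averages of separated points. -/
theorem sudakov_signs (a : ι → ℝ) (t : κ → ι → ℝ) (L Δ : ℝ) (hL : 0 < L) (hΔ : 0 ≤ Δ)
    (ha0 : ∀ j, 0 ≤ a j) (ha1 : ∀ j, a j ≤ 1) (haL : ∀ j, a j ≤ L * a j ^ 2)
    (ht : ∀ i j, |t i j| ≤ 1) (hsep : ∀ i k, i ≠ k → Δ ≤ ∑ j, a j * (t i j - t k j) ^ 2)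
    (hcard : 2 ≤ Fintype.card κ) :
    min ((1 / 2) * Real.log (Fintype.card κ)) (Real.exp (-4) * Δ / (8 * L)) ≤
      𝔼 ε : ι → Bool, finsetMax Finset.univ
        (fun i => ∑ j, a j * boolSign (ε j) * t i j) := by
  classical
  set E : (ι → Bool) → κ → ℝ := fun ε i => ∑ j, a j * boolSign (ε j) * t i j with hE
  set w : (ι → Bool) → κ → ℝ := fun ε i => Real.exp (E ε i) with hw
  set M : (ι → Bool) → ℝ := fun ε => finsetMax Finset.univ (E ε) with hM
  set Z : (ι → Bool) → ℝ := fun ε => ∑ i, w ε i with hZ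
  set N : ℝ := (Fintype.card κ : ℝ) with hN
  have hN2 : (2 : ℝ) ≤ N := by rw [hN]; exact_mod_cast hcard
  have hl : 0 < Real.log N := Real.log_pos (by linarith)
  have hw0 : ∀ ε i, 0 < w ε i := fun ε i => Real.exp_pos _
  have hZ0 : ∀ ε, 0 < Z ε := fun ε => Finset.sum_pos (fun i _ => hw0 ε i) Finset.univ_nonempty
  have hEM : ∀ ε i, E ε i ≤ M ε := fun ε i => le_finsetMax (Finset.mem_univ i) _
  change _ ≤ 𝔼 ε, M ε
  -- If the mean maximum is below (1/2) log N, the Gibbs measure is not concentrated at one point;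
  -- separation then gives it a large variance, and the variance pushes the mean maximum above the
  -- second term of the minimum.
  by_contra! hcon
  obtain ⟨hM1, hM2⟩ := lt_min_iff.1 hcon
  -- the maximal Gibbs weight
  have hMZ : ∀ ε, M ε ≤ Real.log (Z ε) := fun ε => by
    obtain ⟨i, -, hi⟩ := exists_mem_eq_finsetMax (Finset.univ_nonempty (α := κ)) (E ε)
    rw [Real.le_log_iff_exp_le (hZ0 ε)]
    simp only [hM, hi]
    exact Finset.single_le_sum (f := w ε) (fun i _ => (hw0 ε i).le) (Finset.mem_univ i)
  have hZM : ∀ ε, Real.log (Z ε) - M ε ≤ Real.log N := fun ε => by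
    rw [sub_le_iff_le_add, Real.log_le_iff_le_exp (hZ0 ε), Real.exp_add,
      Real.exp_log (by linarith)]
    calc Z ε ≤ ∑ _i : κ, Real.exp (M ε) :=
          Finset.sum_le_sum fun i _ => Real.exp_le_exp.2 (hEM ε i)
      _ = _ := by simp [hN]
  have hElogZ : Real.log N ≤ 𝔼 ε, Real.log (Z ε) := by
    have h0 : 𝔼 ε, (∑ i, E ε i) / N = 0 := by
      rw [← Finset.expect_div, Finset.expect_sum_comm, Finset.sum_eq_zero, zero_div]
      intro i _
      rw [← expect_signed_sum_eq_zero Finset.univ (fun j => a j * t i j)]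
      exact Finset.expect_congr rfl fun ε _ => Finset.sum_congr rfl fun j _ => by ring
    calc Real.log N = 𝔼 ε : ι → Bool, (Real.log N + (∑ i, E ε i) / N) := by
          rw [Finset.expect_add_distrib, h0, Finset.expect_const Finset.univ_nonempty, add_zero]
      _ ≤ _ := Finset.expect_le_expect fun ε _ => log_sum_exp_ge (E ε)
  -- The exponential is the largest Gibbs weight. Since log Z - M has mean at least (1/2) log N, the
  -- bound is 1 - (1/2)(1/2).
  have hpmax : 𝔼 ε, Real.exp (-(Real.log (Z ε) - M ε)) ≤ 3 / 4 := by
    calc _ ≤ 𝔼 ε, (1 - (1 / 2) * ((Real.log (Z ε) - M ε) / Real.log N)) :=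
          Finset.expect_le_expect fun ε _ =>
            exp_neg_le_of_le_log hN2 (sub_nonneg.2 (hMZ ε)) (hZM ε)
      _ = 1 - (1 / 2) * ((𝔼 ε, Real.log (Z ε) - 𝔼 ε, M ε) / Real.log N) := by
          rw [Finset.expect_sub_distrib, Finset.expect_const Finset.univ_nonempty,
            ← Finset.mul_expect, ← Finset.expect_div, Finset.expect_sub_distrib]
      _ ≤ _ := by
          have : 1 / 2 ≤ (𝔼 ε, Real.log (Z ε) - 𝔼 ε, M ε) / Real.log N := by
            rw [le_div_iff₀ hl]; linarith
          linarith
  -- the spread of the Gibbs measure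
  have hspread : ∀ ε, Δ / L * (1 - Real.exp (-(Real.log (Z ε) - M ε))) ≤
      ∑ j, (∑ i, ∑ k, w ε i * w ε k * (a j ^ 2 * (t i j - t k j) ^ 2)) / Z ε ^ 2 := by
    intro ε
    have hpoint : ∀ i k, w ε i * w ε k * (if i = k then 0 else Δ / L) ≤
        ∑ j, w ε i * w ε k * (a j ^ 2 * (t i j - t k j) ^ 2) := by
      intro i k
      rw [← Finset.mul_sum]
      refine mul_le_mul_of_nonneg_left ?_ (mul_pos (hw0 ε i) (hw0 ε k)).le
      split_ifs with h
      · exact Finset.sum_nonneg fun j _ => by positivity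
      · rw [div_le_iff₀ hL]
        refine (hsep i k h).trans ?_
        rw [Finset.sum_mul]
        refine Finset.sum_le_sum fun j _ => ?_
        nlinarith [mul_le_mul_of_nonneg_right (haL j) (sq_nonneg (t i j - t k j))]
    have hdiag : ∑ i, w ε i * w ε i ≤ Real.exp (M ε) * Z ε := by
      rw [hZ, Finset.mul_sum]
      exact Finset.sum_le_sum fun i _ =>
        mul_le_mul_of_nonneg_right (Real.exp_le_exp.2 (hEM ε i)) (hw0 ε i).le
    have hoff : ∑ i, ∑ k, w ε i * w ε k * (if i = k then 0 else Δ / L) =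
        Δ / L * (Z ε ^ 2 - ∑ i, w ε i * w ε i) := by
      have e : ∀ i k, w ε i * w ε k * (if i = k then 0 else Δ / L) =
          Δ / L * (w ε i * w ε k) - (if i = k then Δ / L * (w ε i * w ε k) else 0) := by
        intro i k; split_ifs <;> ring
      simp only [e, Finset.sum_sub_distrib, Finset.sum_ite_eq, Finset.mem_univ, if_true]
      simp only [← Finset.mul_sum]
      rw [mul_sub, sq, hZ, Finset.sum_mul_sum]
      simp only [← Finset.mul_sum]
    rw [← Finset.sum_div, le_div_iff₀ (pow_pos (hZ0 ε) 2)]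
    have hexp : Real.exp (-(Real.log (Z ε) - M ε)) = Real.exp (M ε) / Z ε := by
      rw [neg_sub, Real.exp_sub, Real.exp_log (hZ0 ε)]
    calc Δ / L * (1 - Real.exp (-(Real.log (Z ε) - M ε))) * Z ε ^ 2
        = Δ / L * (Z ε ^ 2 - Real.exp (M ε) * Z ε) := by
          rw [hexp]; field_simp [(hZ0 ε).ne']
      _ ≤ Δ / L * (Z ε ^ 2 - ∑ i, w ε i * w ε i) := by gcongr
      _ = _ := hoff.symm
      _ ≤ ∑ i, ∑ k, ∑ j, w ε i * w ε k * (a j ^ 2 * (t i j - t k j) ^ 2) :=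
          Finset.sum_le_sum fun i _ => Finset.sum_le_sum fun k _ => hpoint i k
      _ = _ := by
          rw [Finset.sum_comm (γ := ι)]
          exact Finset.sum_congr rfl fun i _ => Finset.sum_comm
  have hmean : ∀ ε, ∑ j, a j * boolSign (ε j) * ((∑ i, w ε i * t i j) / Z ε) ≤ M ε := by
    intro ε
    have e : ∑ j, a j * boolSign (ε j) * ((∑ i, w ε i * t i j) / Z ε) =
        (∑ i, w ε i * E ε i) / Z ε := by
      simp only [hE, Finset.mul_sum, Finset.sum_div]
      rw [Finset.sum_comm]
      exact Finset.sum_congr rfl fun i _ => Finset.sum_congr rfl fun j _ => by ring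
    rw [e, div_le_iff₀ (hZ0 ε), mul_comm, hZ, Finset.sum_mul]
    exact Finset.sum_le_sum fun i _ => mul_le_mul_of_nonneg_left (hEM ε i) (hw0 ε i).le
  -- The sum over j of the one-coordinate bounds; the 8 in the statement collects the 1/2 of
  -- integration by parts and 1 - 3/4.
  have hfin : (1 / 2) * Real.exp (-4) * (Δ / L * (1 - 3 / 4)) ≤ 𝔼 ε, M ε := by
    calc _ ≤ (1 / 2) * Real.exp (-4) *
          𝔼 ε, (Δ / L * (1 - Real.exp (-(Real.log (Z ε) - M ε)))) := by
          rw [← Finset.mul_expect, Finset.expect_sub_distrib,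
            Finset.expect_const Finset.univ_nonempty]
          gcongr
      _ ≤ (1 / 2) * Real.exp (-4) * 𝔼 ε, ∑ j,
          (∑ i, ∑ k, w ε i * w ε k * (a j ^ 2 * (t i j - t k j) ^ 2)) / Z ε ^ 2 := by
          gcongr with ε; exact hspread ε
      _ = ∑ j, (1 / 2) * Real.exp (-4) * 𝔼 ε,
          (∑ i, ∑ k, w ε i * w ε k * (a j ^ 2 * (t i j - t k j) ^ 2)) / Z ε ^ 2 := by
          rw [Finset.expect_sum_comm, Finset.mul_sum]
      _ ≤ ∑ j, 𝔼 ε, a j * boolSign (ε j) * ((∑ i, w ε i * t i j) / Z ε) :=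
          Finset.sum_le_sum fun j _ => expect_gibbs_mean_ge a t ha0 ha1 ht w rfl j
      _ = 𝔼 ε, ∑ j, a j * boolSign (ε j) * ((∑ i, w ε i * t i j) / Z ε) :=
          (Finset.expect_sum_comm _ _ _).symm
      _ ≤ _ := Finset.expect_le_expect fun ε _ => hmean ε
  have : (1 / 2) * Real.exp (-4) * (Δ / L * (1 - 3 / 4)) = Real.exp (-4) * Δ / (8 * L) := by
    field_simp; ring
  linarith

end Sudakov

/-! ### Separated nets and grid cells. -/

/-- Greedy selection. No triangle inequality is needed, so d may be a squared distance. -/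
theorem exists_separated_net {α : Type*} (d : α → α → ℝ) (hsymm : ∀ s t, d s t = d t s) (r : ℝ)
    (hr : ∀ t, d t t ≤ r) (I : Finset α) :
    ∃ N ⊆ I, (∀ s ∈ N, ∀ t ∈ N, s ≠ t → r < d s t) ∧ ∀ t ∈ I, ∃ s ∈ N, d t s ≤ r := by
  classical
  induction I using Finset.induction_on with
  | empty => exact ⟨∅, by simp⟩
  | insert a I ha ih =>
    obtain ⟨N, hNI, hsep, hnet⟩ := ih
    by_cases h : ∃ s ∈ N, d a s ≤ r
    · refine ⟨N, hNI.trans (Finset.subset_insert a I), hsep, fun t ht => ?_⟩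
      rcases Finset.mem_insert.1 ht with rfl | ht
      · exact h
      · exact hnet t ht
    · push Not at h
      refine ⟨insert a N, Finset.insert_subset_insert a hNI, fun s hs t ht hst => ?_,
        fun t ht => ?_⟩
      · rcases Finset.mem_insert.1 hs with hs | hs <;> rcases Finset.mem_insert.1 ht with ht | ht
        · exact absurd (hs.trans ht.symm) hst
        · rw [hs]; exact h t ht
        · rw [ht, hsymm]; exact h s hs
        · exact hsep s hs t ht hst
      · rcases Finset.mem_insert.1 ht with rfl | ht
        · exact ⟨t, Finset.mem_insert_self _ _, hr t⟩
        · obtain ⟨s, hs, hd⟩ := hnet t ht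
          exact ⟨s, Finset.mem_insert_of_mem hs, hd⟩

section GridCell

variable {ι : Type*}

open Classical in
/-- The points of `T` in the same grid cell of mesh `1 / m` as `t`, as far as the coordinates in
the first `k` blocks are concerned. -/
noncomputable def gridCell (blk : ι → ℕ) (m : ℕ) (T : Finset (ι → ℝ)) (k : ℕ) (t : ι → ℝ) :
    Finset (ι → ℝ) :=
  T.filter fun s => ∀ j, blk j < k → ⌊(m : ℝ) * s j⌋ = ⌊(m : ℝ) * t j⌋

theorem mem_gridCell {blk : ι → ℕ} {m : ℕ} {T : Finset (ι → ℝ)} {k : ℕ} {s t : ι → ℝ} :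
    s ∈ gridCell blk m T k t ↔ s ∈ T ∧ ∀ j, blk j < k → ⌊(m : ℝ) * s j⌋ = ⌊(m : ℝ) * t j⌋ := by
  simp [gridCell]

end GridCell

/-! ### Small nets and telescoping over blocks. -/

section Blocks

variable {ι : Type*} [Fintype ι] [DecidableEq ι]

/-- The signed sum `∑ lam_j ε_j t_j` over the coordinates in `B`. -/
def signSum (lam : ι → ℝ) (B : Finset ι) (ε : ι → Bool) (t : ι → ℝ) : ℝ :=
  ∑ j ∈ B, lam j * boolSign (ε j) * t j

/-- A set on which the Rademacher average is small has a small net in the weighted `ℓ²` distance. -/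
theorem exists_small_net (lam : ι → ℝ) (B : Finset ι) (I : Finset (ι → ℝ)) {Λ L r y : ℝ}
    (hI : ∀ t ∈ I, ∀ j, |t j| ≤ 1) (hΛ : 0 < Λ) (hL : 0 < L) (hr : 0 ≤ r) (hy : 0 ≤ y)
    (hlam : ∀ j, 0 ≤ lam j) (hlamΛ : ∀ j ∈ B, lam j ≤ Λ) (hΛL : ∀ j ∈ B, Λ ≤ L * lam j)
    (h1 : 𝔼 ε, finsetMax I (signSum lam B ε) < Λ * ((1 / 2) * y))
    (h2 : 𝔼 ε, finsetMax I (signSum lam B ε) < Real.exp (-4) * r / (8 * L)) :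
    ∃ N ⊆ I, (N.card : ℝ) ≤ Real.exp y ∧
      ∀ t ∈ I, ∃ s ∈ N, ∑ j ∈ B, lam j * (t j - s j) ^ 2 ≤ r := by
  obtain ⟨N, hNI, hsep, hnet⟩ := exists_separated_net
    (fun t s : ι → ℝ => ∑ j ∈ B, lam j * (t j - s j) ^ 2)
    (fun s t => Finset.sum_congr rfl fun j _ => by ring) r (fun t => by simpa using hr) I
  refine ⟨N, hNI, ?_, hnet⟩
  rcases Nat.lt_or_ge N.card 2 with hc | hc
  · have : (N.card : ℝ) ≤ 1 := by exact_mod_cast Nat.le_of_lt_succ hc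
    exact this.trans (Real.one_le_exp hy)
  have hne : N.Nonempty := Finset.card_pos.1 (by omega)
  have : Nonempty N := hne.to_subtype
  -- Dividing by Λ brings the weights on B into [1/L, 1], as `sudakov_signs` requires.
  set a : ι → ℝ := fun j => if j ∈ B then lam j / Λ else 0 with ha
  have ha0 : ∀ j, 0 ≤ a j := fun j => by
    simp only [ha]; split_ifs
    · exact div_nonneg (hlam j) hΛ.le
    · exact le_rfl
  have ha1 : ∀ j, a j ≤ 1 := fun j => by
    simp only [ha]; split_ifs with h
    · exact (div_le_one hΛ).2 (hlamΛ j h)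
    · exact zero_le_one
  have haL : ∀ j, a j ≤ L * a j ^ 2 := fun j => by
    by_cases h : j ∈ B
    · have : 1 ≤ L * a j := by
        simp only [ha, if_pos h]
        rw [← mul_div_assoc, le_div_iff₀ hΛ, one_mul]
        exact hΛL j h
      nlinarith [ha0 j]
    · simp [ha, h]
  have hsum : ∀ f : ι → ℝ, ∑ j, a j * f j = (∑ j ∈ B, lam j * f j) / Λ := fun f => by
    simp only [ha, ite_mul, zero_mul, Finset.sum_ite_mem, Finset.univ_inter, Finset.sum_div]
    exact Finset.sum_congr rfl fun j _ => by ring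
  have hsud := sudakov_signs (κ := N) a (fun i => i.1) L (r / Λ) hL (by positivity) ha0 ha1 haL
    (fun i j => hI i.1 (hNI i.2) j) (fun i k hik => by
      rw [hsum fun j => (i.1 j - k.1 j) ^ 2]
      exact div_le_div_of_nonneg_right
        (hsep i.1 i.2 k.1 k.2 fun e => hik (Subtype.ext e)).le hΛ.le) (by simpa using hc)
  have hle : 𝔼 ε : ι → Bool, finsetMax (Finset.univ : Finset N)
      (fun i => ∑ j, a j * boolSign (ε j) * i.1 j) ≤
      (𝔼 ε, finsetMax I (signSum lam B ε)) / Λ := by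
    rw [Finset.expect_div]
    refine Finset.expect_le_expect fun ε _ => finsetMax_le Finset.univ_nonempty fun i _ => ?_
    have e : ∑ j, a j * boolSign (ε j) * i.1 j = signSum lam B ε i.1 / Λ := by
      simp only [mul_assoc]
      rw [hsum fun j => boolSign (ε j) * i.1 j]
      simp only [signSum, mul_assoc]
    rw [e]
    exact div_le_div_of_nonneg_right (le_finsetMax (hNI i.2) _) hΛ.le
  have h := hsud.trans hle
  rw [Fintype.card_coe] at h
  have hlog : Real.log N.card ≤ y := by
    rcases min_le_iff.1 h with h' | h'
    · rw [le_div_iff₀ hΛ] at h'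
      by_contra! hcon
      nlinarith
    · exfalso
      rw [le_div_iff₀ hΛ] at h'
      have : Real.exp (-4) * (r / Λ) / (8 * L) * Λ = Real.exp (-4) * r / (8 * L) := by field_simp
      linarith
  have hNpos : (0 : ℝ) < N.card := by exact_mod_cast hne.card_pos
  exact (Real.log_le_iff_le_exp hNpos).1 hlog

variable (lam : ι → ℝ) (blk : ι → ℕ) (m : ℕ) (T : Finset (ι → ℝ))

/-- The expected maximum, over a grid cell, of the signed sum over the remaining blocks. -/
noncomputable def tailMean (k : ℕ) (t : ι → ℝ) : ℝ :=
  𝔼 ε, finsetMax (gridCell blk m T k t) (signSum lam (Finset.univ.filter fun j => k ≤ blk j) ε)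

variable {lam blk m T}

/-- Given the signs on block k, take the maximiser s₀ of the block sum over I and then only compete
within the finer cell of s₀. Points of that cell differ by at most 1/m on block k, which costs
(block mass)/m, and averaging over the remaining independent signs leaves `tailMean` (k+1) at s₀. -/
theorem tailMean_step (hm : 0 < m) (hlam : ∀ j, 0 ≤ lam j) {k : ℕ} {t : ι → ℝ}
    {I : Finset (ι → ℝ)} (hI : I.Nonempty) (hIt : I ⊆ gridCell blk m T k t) {c : ℝ}
    (hc : ∀ s ∈ I, c ≤ tailMean lam blk m T (k + 1) s) :
    𝔼 ε, finsetMax I (signSum lam (Finset.univ.filter fun j => blk j = k) ε) + c ≤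
      tailMean lam blk m T k t + (∑ j with blk j = k, lam j) / m := by
  have hm' : (0 : ℝ) < m := by exact_mod_cast hm
  set B := Finset.univ.filter fun j => blk j = k with hB
  set F := Finset.univ.filter fun j => k + 1 ≤ blk j with hF
  set p := ∑ j ∈ B, lam j with hp
  have hsplit : ∀ (ε ε' : ι → Bool) (s : ι → ℝ),
      signSum lam (Finset.univ.filter fun j => k ≤ blk j)
        (fun j => if blk j = k then ε j else ε' j) s = signSum lam B ε s + signSum lam F ε' s := by
    intro ε ε' s
    have hu : (Finset.univ.filter fun j => k ≤ blk j) = B ∪ F := by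
      ext j; simp only [hB, hF, Finset.mem_filter, Finset.mem_univ, true_and, Finset.mem_union]
      omega
    have hd : Disjoint B F := by
      rw [Finset.disjoint_left]
      intro j hj hj'
      simp only [hB, hF, Finset.mem_filter, Finset.mem_univ, true_and] at hj hj'
      omega
    simp only [signSum]
    rw [hu, Finset.sum_union hd]
    congr 1
    · refine Finset.sum_congr rfl fun j hj => ?_
      rw [if_pos (by simpa [hB] using hj)]
    · refine Finset.sum_congr rfl fun j hj => ?_
      rw [if_neg (by simp only [hF, Finset.mem_filter] at hj; omega)]
  have hnear : ∀ (ε : ι → Bool) (s s' : ι → ℝ), s ∈ gridCell blk m T (k + 1) s' →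
      signSum lam B ε s' - p / m ≤ signSum lam B ε s := by
    intro ε s s' hs
    have hs2 := (mem_gridCell.1 hs).2
    rw [sub_le_iff_le_add, ← sub_le_iff_le_add', hp, Finset.sum_div]
    simp only [signSum]
    rw [← Finset.sum_sub_distrib]
    refine Finset.sum_le_sum fun j hj => ?_
    have hfl := Int.abs_sub_lt_one_of_floor_eq_floor
      (hs2 j (by simp only [hB, Finset.mem_filter] at hj; omega))
    have h1 : |s' j - s j| ≤ 1 / m := by
      rw [le_div_iff₀ hm', abs_sub_comm, ← abs_of_pos hm', ← abs_mul]
      calc _ = |(m : ℝ) * s j - m * s' j| := by congr 1; ring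
        _ ≤ 1 := hfl.le
    calc lam j * boolSign (ε j) * s' j - lam j * boolSign (ε j) * s j
        ≤ |lam j * boolSign (ε j) * s' j - lam j * boolSign (ε j) * s j| := le_abs_self _
      _ = lam j * |s' j - s j| := by
          rw [← mul_sub, abs_mul, abs_mul, abs_boolSign, mul_one, abs_of_nonneg (hlam j)]
      _ ≤ lam j * (1 / m) := mul_le_mul_of_nonneg_left h1 (hlam j)
      _ = lam j / m := by ring
  rw [← sub_le_iff_le_add, tailMean, ← expect_mix (fun j => blk j = k)
    (fun ε => finsetMax (gridCell blk m T k t)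
      (signSum lam (Finset.univ.filter fun j => k ≤ blk j) ε))]
  have hconst : ∀ c : ℝ, 𝔼 _ε : ι → Bool, c = c :=
    fun c => Finset.expect_const Finset.univ_nonempty c
  calc _ = 𝔼 ε, (finsetMax I (signSum lam B ε) + c - p / m) := by
        rw [Finset.expect_sub_distrib, Finset.expect_add_distrib, hconst, hconst]
    _ ≤ _ := by
        refine Finset.expect_le_expect fun ε _ => ?_
        obtain ⟨s₀, hs₀, e⟩ := exists_mem_eq_finsetMax hI (signSum lam B ε)
        rw [e]
        have hs₀t := mem_gridCell.1 (hIt hs₀)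
        have hne : (gridCell blk m T (k + 1) s₀).Nonempty :=
          ⟨s₀, mem_gridCell.2 ⟨hs₀t.1, fun _ _ => rfl⟩⟩
        calc signSum lam B ε s₀ + c - p / m
            ≤ (signSum lam B ε s₀ - p / m) + tailMean lam blk m T (k + 1) s₀ := by
              linarith [hc s₀ hs₀]
          _ = 𝔼 ε', ((signSum lam B ε s₀ - p / m) +
                finsetMax (gridCell blk m T (k + 1) s₀) (signSum lam F ε')) := by
              rw [Finset.expect_add_distrib, hconst]; rfl
          _ ≤ _ := by
              refine Finset.expect_le_expect fun ε' _ => ?_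
              rw [← le_sub_iff_add_le']
              refine finsetMax_le hne fun s hs => ?_
              have hst : s ∈ gridCell blk m T k t := by
                have := mem_gridCell.1 hs
                exact mem_gridCell.2 ⟨this.1, fun j hj =>
                  (this.2 j (by omega)).trans (hs₀t.2 j hj)⟩
              have := le_finsetMax hst
                (signSum lam (Finset.univ.filter fun j => k ≤ blk j)
                  (fun j => if blk j = k then ε j else ε' j))
              rw [hsplit] at this
              linarith [hnear ε s s₀ hs]

/-- The case I = {t} of `tailMean_step`: a single signed sum has mean zero. A drop can thus be
negative only by the discretisation error. -/
theorem neg_le_tailMean_sub (hm : 0 < m) (hlam : ∀ j, 0 ≤ lam j) {k : ℕ} {t : ι → ℝ}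
    (ht : t ∈ T) :
    -((∑ j with blk j = k, lam j) / m) ≤
      tailMean lam blk m T k t - tailMean lam blk m T (k + 1) t := by
  have h := tailMean_step (blk := blk) (T := T) (k := k) (t := t) (I := {t}) hm hlam
    (Finset.singleton_nonempty t)
    (by simpa using mem_gridCell.2 ⟨ht, fun _ _ => rfl⟩)
    (c := tailMean lam blk m T (k + 1) t) (by simp)
  have h0 : 𝔼 ε, finsetMax {t} (signSum lam (Finset.univ.filter fun j => blk j = k) ε) = 0 := by
    rw [← expect_signed_sum_eq_zero (Finset.univ.filter fun j => blk j = k)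
      (fun j => lam j * t j)]
    refine Finset.expect_congr rfl fun ε _ => ?_
    obtain ⟨s, hs, e⟩ := exists_mem_eq_finsetMax (Finset.singleton_nonempty t)
      (signSum lam (Finset.univ.filter fun j => blk j = k) ε)
    rw [e, Finset.mem_singleton.1 hs]
    exact Finset.sum_congr rfl fun j _ => by ring
  linarith

/-- Points whose grid cell loses little when passing to the next block are covered by a small
net. -/
theorem exists_block_net (hm : 0 < m) (hlam : ∀ j, 0 ≤ lam j) (hT : ∀ t ∈ T, ∀ j, |t j| ≤ 1)
    (k : ℕ) {Λ L r y v : ℝ} (hΛ : 0 < Λ) (hL : 0 < L) (hr : 0 ≤ r) (hy : 0 ≤ y)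
    (hlamΛ : ∀ j, blk j = k → lam j ≤ Λ) (hΛL : ∀ j, blk j = k → Λ ≤ L * lam j)
    (h1 : v + (∑ j with blk j = k, lam j) / m < Λ * ((1 / 2) * y))
    (h2 : v + (∑ j with blk j = k, lam j) / m < Real.exp (-4) * r / (8 * L)) :
    ∃ N ⊆ T, (N.card : ℝ) ≤
        (2 * m + 1 : ℝ) ^ (Finset.univ.filter fun j => blk j < k).card * Real.exp y ∧
      ∀ t ∈ T, tailMean lam blk m T k t - tailMean lam blk m T (k + 1) t ≤ v →
        ∃ s ∈ N, ∑ j with blk j = k, lam j * (t j - s j) ^ 2 ≤ r := by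
  classical
  have hm' : (0 : ℝ) < m := by exact_mod_cast hm
  -- The code names the cell of t on the earlier blocks. Points with equal codes share `tailMean` k,
  -- and codes take at most 2m + 1 values per earlier coordinate, which is the source of the power
  -- in the cardinality bound.
  set code : (ι → ℝ) → ι → ℤ := fun t j => if blk j < k then ⌊(m : ℝ) * t j⌋ else 0 with hcode
  set I : (ι → ℤ) → Finset (ι → ℝ) := fun c => T.filter fun t =>
    code t = c ∧ tailMean lam blk m T k t - tailMean lam blk m T (k + 1) t ≤ v with hI
  have hnet : ∀ c, ∃ N ⊆ I c, (N.card : ℝ) ≤ Real.exp y ∧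
      ∀ t ∈ I c, ∃ s ∈ N, ∑ j with blk j = k, lam j * (t j - s j) ^ 2 ≤ r := by
    intro c
    rcases (I c).eq_empty_or_nonempty with he | hne
    · exact ⟨∅, by simp, by simpa using (Real.exp_pos y).le, by simp [he]⟩
    have ⟨t₀, ht₀⟩ := hne
    have hcell : ∀ s ∈ I c, s ∈ gridCell blk m T k t₀ := fun s hs => by
      simp only [hI, Finset.mem_filter] at hs ht₀
      refine mem_gridCell.2 ⟨hs.1, fun j hj => ?_⟩
      have := congrFun (hs.2.1.trans ht₀.2.1.symm) j
      simpa [hcode, hj] using this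
    -- With this c the values at t₀ cancel, leaving the bound v + (block mass)/m for the Rademacher
    -- average of block k over `I c`.
    have hstep := tailMean_step (lam := lam) hm hlam hne hcell
      (c := tailMean lam blk m T k t₀ - v) (fun s hs => by
        have e : tailMean lam blk m T k s = tailMean lam blk m T k t₀ := by
          have hcell' := (mem_gridCell.1 (hcell s hs)).2
          have : gridCell blk m T k s = gridCell blk m T k t₀ := by
            ext u
            simp only [mem_gridCell]
            refine and_congr_right fun _ => forall_congr' fun j => ?_
            exact imp_congr_right fun hj => by rw [hcell' j hj]
          rw [tailMean, this, ← tailMean]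
        simp only [hI, Finset.mem_filter] at hs
        linarith [hs.2.2])
    exact exists_small_net lam (Finset.univ.filter fun j => blk j = k) (I c)
      (fun t ht => hT t (Finset.mem_filter.1 ht).1) hΛ hL hr hy hlam
      (fun j hj => hlamΛ j (by simpa using hj)) (fun j hj => hΛL j (by simpa using hj))
      (by linarith) (by linarith)
  choose N hNI hNcard hNnet using hnet
  refine ⟨(T.image code).biUnion N, ?_, ?_, ?_⟩
  · refine Finset.biUnion_subset.2 fun c _ => (hNI c).trans (Finset.filter_subset _ _)
  · have hC : (T.image code).card ≤ (2 * m + 1) ^ (Finset.univ.filter fun j => blk j < k).card := by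
      calc (T.image code).card ≤ (Fintype.piFinset fun j =>
            if blk j < k then Finset.Icc (-(m : ℤ)) m else {0}).card := by
            refine Finset.card_le_card fun c hc => ?_
            obtain ⟨t, ht, rfl⟩ := Finset.mem_image.1 hc
            rw [Fintype.mem_piFinset]
            intro j
            simp only [hcode]
            split_ifs with hj
            · have hb := abs_le.1 (hT t ht j)
              rw [Finset.mem_Icc, Int.le_floor, Int.floor_le_iff]
              push_cast
              constructor <;> nlinarith
            · simp
        _ = _ := by
            rw [Fintype.card_piFinset]
            have : ∀ j, (if blk j < k then Finset.Icc (-(m : ℤ)) m else {0}).card =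
                if blk j < k then 2 * m + 1 else 1 := fun j => by
              split_ifs
              · rw [Int.card_Icc]; omega
              · simp
            simp only [this]
            rw [Finset.prod_ite]; simp
    calc (((T.image code).biUnion N).card : ℝ) ≤ ∑ c ∈ T.image code, ((N c).card : ℝ) := by
          exact_mod_cast Finset.card_biUnion_le
      _ ≤ ∑ _c ∈ T.image code, Real.exp y := Finset.sum_le_sum fun c _ => hNcard c
      _ = (T.image code).card * Real.exp y := by simp
      _ ≤ _ := by
          refine mul_le_mul_of_nonneg_right ?_ (Real.exp_pos y).le
          exact_mod_cast hC
  · intro t ht htv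
    obtain ⟨s, hs, hd⟩ := hNnet (code t) t (Finset.mem_filter.2 ⟨ht, rfl, htv⟩)
    exact ⟨s, Finset.mem_biUnion.2 ⟨code t, Finset.mem_image_of_mem _ ht, hs⟩, hd⟩

/-- The contribution of one block to the telescoping sum. -/
theorem block_contribution_le (hm : 0 < m) (hlam : ∀ j, 0 ≤ lam j) (hT : ∀ t ∈ T, ∀ j, |t j| ≤ 1)
    (k : ℕ) {A K δ U : ℝ} (hA : 0 < A) (hK : 0 < K) (hδ : 0 < δ) (hU : 0 ≤ U)
    {N : Finset (ι → ℝ)}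
    (hN : ∀ t ∈ T, tailMean lam blk m T k t - tailMean lam blk m T (k + 1) t ≤
        K * (∑ j with blk j = k, lam j) / A →
        ∃ s ∈ N, ∑ j with blk j = k, lam j * (t j - s j) ^ 2 ≤
          δ ^ 2 * ∑ j with blk j = k, lam j)
    (b : ι → ℝ) (hUN : ∀ s ∈ N, ∑ j with blk j = k, lam j * b j * s j ≤ U)
    {t : ι → ℝ} (ht : t ∈ T) :
    (∑ j with blk j = k, lam j * b j * t j) -
        A * (tailMean lam blk m T k t - tailMean lam blk m T (k + 1) t) ≤
      (1 / (4 * K) + δ / 2) * (∑ j with blk j = k, lam j * b j ^ 2) +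
        (δ / 2 + A / m) * (∑ j with blk j = k, lam j) + U := by
  have hm' : (0 : ℝ) < m := by exact_mod_cast hm
  set B := Finset.univ.filter fun j => blk j = k with hB
  set p := ∑ j ∈ B, lam j with hp
  set Δ := tailMean lam blk m T k t - tailMean lam blk m T (k + 1) t with hΔ
  have hp0 : 0 ≤ p := Finset.sum_nonneg fun j _ => hlam j
  have hb0 : 0 ≤ ∑ j ∈ B, lam j * b j ^ 2 :=
    Finset.sum_nonneg fun j _ => mul_nonneg (hlam j) (sq_nonneg _)
  -- Small drop: pass to a net point by Young's inequality with parameter δ; the term A/m covers a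
  -- possibly negative drop. Large drop: A * Δ exceeds K * p, which pays for |b| ≤ K + b²/(4K), and
  -- no net is needed.
  by_cases hv : Δ ≤ K * p / A
  · obtain ⟨s, hs, hd⟩ := hN t ht hv
    have h1 : -(p / m) ≤ Δ := neg_le_tailMean_sub hm hlam ht
    have h2 : ∑ j ∈ B, lam j * b j * t j ≤ ∑ j ∈ B, lam j * b j * s j +
        ((δ / 2) * ∑ j ∈ B, lam j * b j ^ 2 +
          (1 / (2 * δ)) * ∑ j ∈ B, lam j * (t j - s j) ^ 2) := by
      rw [Finset.mul_sum, Finset.mul_sum, ← Finset.sum_add_distrib, ← Finset.sum_add_distrib]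
      refine Finset.sum_le_sum fun j _ => ?_
      have : b j * (t j - s j) ≤ δ / 2 * b j ^ 2 + 1 / (2 * δ) * (t j - s j) ^ 2 := by
        have e : δ / 2 * b j ^ 2 + 1 / (2 * δ) * (t j - s j) ^ 2 - b j * (t j - s j) =
            (δ * b j - (t j - s j)) ^ 2 / (2 * δ) := by field_simp; ring
        have : 0 ≤ (δ * b j - (t j - s j)) ^ 2 / (2 * δ) := by positivity
        linarith
      nlinarith [mul_le_mul_of_nonneg_left this (hlam j)]
    have h3 : (1 / (2 * δ)) * ∑ j ∈ B, lam j * (t j - s j) ^ 2 ≤ δ / 2 * p := by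
      calc _ ≤ (1 / (2 * δ)) * (δ ^ 2 * p) := by gcongr
        _ = δ / 2 * p := by field_simp
    have h4 : -(A / m * p) ≤ A * Δ := by
      calc -(A / m * p) = A * -(p / m) := by ring
        _ ≤ _ := mul_le_mul_of_nonneg_left h1 hA.le
    have h5 : 0 ≤ 1 / (4 * K) * ∑ j ∈ B, lam j * b j ^ 2 := by positivity
    have h6 := hUN s hs
    linarith
  · have h1 : K * p ≤ A * Δ := by
      have := (div_lt_iff₀ hA).1 (not_le.1 hv)
      linarith
    have h2 : ∑ j ∈ B, lam j * b j * t j ≤ K * p + 1 / (4 * K) * ∑ j ∈ B, lam j * b j ^ 2 := by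
      rw [hp, Finset.mul_sum, Finset.mul_sum, ← Finset.sum_add_distrib]
      refine Finset.sum_le_sum fun j _ => ?_
      have h3 : b j * t j ≤ |b j| := by
        calc b j * t j ≤ |b j * t j| := le_abs_self _
          _ = |b j| * |t j| := abs_mul _ _
          _ ≤ |b j| * 1 := mul_le_mul_of_nonneg_left (hT t ht j) (abs_nonneg _)
          _ = _ := mul_one _
      have h4 : |b j| ≤ K + 1 / (4 * K) * b j ^ 2 := by
        have e : K + 1 / (4 * K) * b j ^ 2 - |b j| = (2 * K - |b j|) ^ 2 / (4 * K) := by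
          rw [← sq_abs (b j)]; field_simp; ring
        have : 0 ≤ (2 * K - |b j|) ^ 2 / (4 * K) := by positivity
        linarith
      nlinarith [mul_le_mul_of_nonneg_left (h3.trans h4) (hlam j)]
    have h5 : 0 ≤ δ / 2 * ∑ j ∈ B, lam j * b j ^ 2 := by positivity
    have h6 : 0 ≤ (δ / 2 + A / m) * p := by positivity
    linarith

/-- Telescoping over the blocks. -/
theorem sum_le_tailMean_add {n : ℕ} (hn : ∀ j, blk j < n) {A : ℝ} (H : ℕ → ℝ) (b : ι → ℝ)
    {t : ι → ℝ} (ht : t ∈ T)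
    (hH : ∀ k < n, (∑ j with blk j = k, lam j * b j * t j) -
      A * (tailMean lam blk m T k t - tailMean lam blk m T (k + 1) t) ≤ H k) :
    ∑ j, lam j * b j * t j ≤ A * 𝔼 ε, finsetMax T (signSum lam Finset.univ ε) +
      ∑ k ∈ Finset.range n, H k := by
  have h0 : tailMean lam blk m T 0 t = 𝔼 ε, finsetMax T (signSum lam Finset.univ ε) := by
    have : gridCell blk m T 0 t = T := by ext s; simp [mem_gridCell]
    simp [tailMean, this]
  have hn0 : tailMean lam blk m T n t = 0 := by
    have e : (Finset.univ.filter fun j => n ≤ blk j) = ∅ :=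
      Finset.filter_eq_empty_iff.2 fun j _ => not_le.2 (hn j)
    rw [tailMean, e]
    refine Finset.expect_eq_zero fun ε _ => ?_
    obtain ⟨s, -, e⟩ := exists_mem_eq_finsetMax
      (s := gridCell blk m T n t) ⟨t, mem_gridCell.2 ⟨ht, fun _ _ => rfl⟩⟩ (signSum lam ∅ ε)
    rw [e]; simp [signSum]
  have hsum : ∑ j, lam j * b j * t j =
      ∑ k ∈ Finset.range n, ∑ j with blk j = k, lam j * b j * t j :=
    (Finset.sum_fiberwise_of_maps_to (fun j _ => Finset.mem_range.2 (hn j)) _).symm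
  have htel : ∑ k ∈ Finset.range n,
      (tailMean lam blk m T k t - tailMean lam blk m T (k + 1) t) =
      𝔼 ε, finsetMax T (signSum lam Finset.univ ε) := by
    rw [Finset.sum_range_sub', h0, hn0, sub_zero]
  have hle := Finset.sum_le_sum fun k hk => hH k (Finset.mem_range.1 hk)
  rw [Finset.sum_sub_distrib, ← Finset.mul_sum, htel, ← hsum] at hle
  linarith

end Blocks

/-! ### Subgaussian systems and the ψ₂ union bound. -/

/-- A real system with second moments at most `1` all of whose linear combinations are
subgaussian with constant `C`. -/
structure IsSubgaussianSystem {Ω ι : Type*} [MeasurableSpace Ω] [Fintype ι] (C : ℝ)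
    (φ : ι → Ω → ℝ) (μ : Measure Ω) : Prop where
  aestronglyMeasurable : ∀ j, AEStronglyMeasurable (φ j) μ
  integrable_sq : ∀ j, Integrable (fun ω => φ j ω ^ 2) μ
  integral_sq_le : ∀ j, ∫ ω, φ j ω ^ 2 ∂μ ≤ 1
  integrable_exp : ∀ (a : ι → ℝ) (K : ℝ), 0 < K → C * √(∑ j, a j ^ 2) ≤ K →
    Integrable (fun ω => Real.exp (((∑ j, a j * φ j ω) / K) ^ 2)) μ
  integral_exp_le : ∀ (a : ι → ℝ) (K : ℝ), 0 < K → C * √(∑ j, a j ^ 2) ≤ K →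
    ∫ ω, Real.exp (((∑ j, a j * φ j ω) / K) ^ 2) ∂μ ≤ 2

theorem half_le_log_two_mul {M : ℝ} (hM : 1 ≤ M) : 1 / 2 ≤ Real.log (2 * M) := by
  have h1 : Real.log 2 ≤ Real.log (2 * M) := Real.log_le_log (by norm_num) (by linarith)
  linarith [Real.log_two_gt_d9]

/-- The pointwise form of the `ψ₂` union bound. -/
theorem le_sqrt_log_add {M u X : ℝ} (hM : 1 ≤ M) (hX : Real.exp (u ^ 2) ≤ X) :
    u ≤ √(Real.log (2 * M)) + (X / (2 * M) - 1) / (2 * √(Real.log (2 * M))) := by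
  have hlog := half_le_log_two_mul hM
  set l := √(Real.log (2 * M)) with hl
  have hl0 : 0 < l := Real.sqrt_pos.2 (by linarith)
  have hl2 : l ^ 2 = Real.log (2 * M) := Real.sq_sqrt (by linarith)
  have h1 : Real.exp (u ^ 2) / (2 * M) ≤ X / (2 * M) :=
    div_le_div_of_nonneg_right hX (by linarith)
  -- The tangent line of exp at l², where exp(l²) = 2M.
  have h2 : u ^ 2 - l ^ 2 + 1 ≤ Real.exp (u ^ 2) / (2 * M) := by
    have := Real.add_one_le_exp (u ^ 2 - l ^ 2)
    rwa [Real.exp_sub, hl2, Real.exp_log (by linarith), ← hl2] at this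
  have h3 : u ^ 2 - l ^ 2 ≤ X / (2 * M) - 1 := by linarith
  have h4 : (u ^ 2 - l ^ 2) / (2 * l) ≤ (X / (2 * M) - 1) / (2 * l) :=
    div_le_div_of_nonneg_right h3 (by positivity)
  have h5 : u ≤ l + (u ^ 2 - l ^ 2) / (2 * l) := by
    have e : l + (u ^ 2 - l ^ 2) / (2 * l) - u = (u - l) ^ 2 / (2 * l) := by
      field_simp; ring
    have : 0 ≤ (u - l) ^ 2 / (2 * l) := by positivity
    linarith
  linarith

/-- Holds because log(2M) ≥ 1/2. Nonnegativity of the majorant is needed at points with a large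
drop, where no net point is available. -/
theorem sqrt_log_add_nonneg {M X : ℝ} (hM : 1 ≤ M) (hX : 0 ≤ X) :
    0 ≤ √(Real.log (2 * M)) + (X / (2 * M) - 1) / (2 * √(Real.log (2 * M))) := by
  have hlog := half_le_log_two_mul hM
  set l := √(Real.log (2 * M)) with hl
  have hl0 : 0 < l := Real.sqrt_pos.2 (by linarith)
  have hl2 : l ^ 2 = Real.log (2 * M) := Real.sq_sqrt (by linarith)
  have e : l + (X / (2 * M) - 1) / (2 * l) = (2 * l ^ 2 - 1 + X / (2 * M)) / (2 * l) := by
    field_simp; ring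
  rw [e]
  have : 0 ≤ X / (2 * M) := by positivity
  exact div_nonneg (by linarith) (by positivity)

section

variable {ι Ω : Type*} [Fintype ι] [MeasurableSpace Ω] {μ : Measure Ω}
  [IsProbabilityMeasure μ] {C : ℝ} {φ : ι → Ω → ℝ}

/-- The `ψ₂` union bound with an explicit integrable majorant. -/
theorem IsSubgaussianSystem.exists_majorant (hφ : IsSubgaussianSystem C φ μ)
    (N : Finset (ι → ℝ)) {M D : ℝ} (hM : 1 ≤ M) (hNM : (N.card : ℝ) ≤ M) (hD : 0 < D)
    (hND : ∀ s ∈ N, C * √(∑ j, s j ^ 2) ≤ D) :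
    ∃ U : Ω → ℝ, Integrable U μ ∧ (∀ ω, 0 ≤ U ω) ∧ (∀ ω, ∀ s ∈ N, ∑ j, s j * φ j ω ≤ U ω) ∧
      ∫ ω, U ω ∂μ ≤ D * √(Real.log (2 * M)) := by
  set l := √(Real.log (2 * M)) with hl
  have hl0 : 0 < l := Real.sqrt_pos.2 (by linarith [half_le_log_two_mul hM])
  set X : Ω → ℝ := fun ω => ∑ s ∈ N, Real.exp (((∑ j, s j * φ j ω) / D) ^ 2) with hX
  have hXint : Integrable X μ :=
    integrable_finsetSum _ fun s hs => hφ.integrable_exp s D hD (hND s hs)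
  have hXle : ∫ ω, X ω ∂μ ≤ 2 * M := by
    rw [hX, integral_finsetSum _ fun s hs => hφ.integrable_exp s D hD (hND s hs)]
    calc _ ≤ ∑ _s ∈ N, (2 : ℝ) := Finset.sum_le_sum fun s hs => hφ.integral_exp_le s D hD (hND s hs)
      _ = 2 * N.card := by rw [Finset.sum_const, nsmul_eq_mul]; ring
      _ ≤ _ := by linarith
  have hi1 : Integrable (fun ω => (X ω / (2 * M) - 1) / (2 * l)) μ :=
    ((hXint.div_const _).sub (integrable_const _)).div_const _
  refine ⟨fun ω => D * (l + (X ω / (2 * M) - 1) / (2 * l)),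
    ((integrable_const _).add hi1).const_mul _, fun ω => ?_, fun ω s hs => ?_, ?_⟩
  · exact mul_nonneg hD.le (sqrt_log_add_nonneg hM
      (Finset.sum_nonneg fun s _ => (Real.exp_pos _).le))
  · have hle : Real.exp (((∑ j, s j * φ j ω) / D) ^ 2) ≤ X ω :=
      Finset.single_le_sum (f := fun s : ι → ℝ => Real.exp (((∑ j, s j * φ j ω) / D) ^ 2))
        (fun s _ => (Real.exp_pos _).le) hs
    have := le_sqrt_log_add hM hle
    rw [div_le_iff₀ hD] at this
    linarith
  · rw [integral_const_mul, integral_add (integrable_const _) hi1, integral_div,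
      integral_sub (hXint.div_const _) (integrable_const _), integral_div]
    simp only [integral_const, probReal_univ, one_smul]
    refine mul_le_mul_of_nonneg_left ?_ hD.le
    -- Each of the at most M exponentials has integral at most 2, so the correction term has
    -- nonpositive mean.
    have h1 : (∫ ω, X ω ∂μ) / (2 * M) ≤ 1 := (div_le_one (by linarith)).2 hXle
    have : ((∫ ω, X ω ∂μ) / (2 * M) - 1) / (2 * l) ≤ 0 :=
      div_nonpos_of_nonpos_of_nonneg (by linarith) (by positivity)
    linarith

theorem sqrt_mul_le_half {x y s : ℝ} (hx : 0 ≤ x) (hy : 0 ≤ y) (hs : 0 ≤ s) :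
    √(s * (x * y)) ≤ 1 / 2 * √s * (x + y) := by
  rw [Real.sqrt_mul hs]
  have : √(x * y) ≤ 1 / 2 * (x + y) := by
    rw [Real.sqrt_le_left (by positivity)]
    nlinarith [sq_nonneg (x - y)]
  nlinarith [mul_le_mul_of_nonneg_left this (Real.sqrt_nonneg s)]

theorem sqrt_add_three_le {x y z : ℝ} (hx : 0 ≤ x) (hy : 0 ≤ y) (hz : 0 ≤ z) :
    √(x + y + z) ≤ √x + √y + √z := by
  rw [Real.sqrt_le_left (by positivity)]
  nlinarith [Real.sq_sqrt hx, Real.sq_sqrt hy, Real.sq_sqrt hz,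
    mul_nonneg (Real.sqrt_nonneg x) (Real.sqrt_nonneg y),
    mul_nonneg (Real.sqrt_nonneg x) (Real.sqrt_nonneg z),
    mul_nonneg (Real.sqrt_nonneg y) (Real.sqrt_nonneg z)]

/-! ### Comparison for lacunary weights. -/

variable [DecidableEq ι]

/-- A decomposition of the coordinates into lacunary blocks of comparable weights. -/
structure IsLacunary {ι : Type*} [Fintype ι] (lam : ι → ℝ) (blk : ι → ℕ) (θ L τ S : ℝ) : Prop where
  pos : ∀ j, 0 < lam j
  gap : ∀ i j, blk i < blk j → lam j ≤ θ ^ (blk j - blk i) * lam i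
  comparable : ∀ i j, blk i = blk j → lam i ≤ L * lam j
  small : ∀ j, lam j ≤ θ ^ blk j * (τ * S)
  sum_le : ∑ j, lam j ≤ S

variable {lam : ι → ℝ} {blk : ι → ℕ} {m : ℕ} {T : Finset (ι → ℝ)} {θ L τ S : ℝ}

/-- With p the block mass, Λ its largest weight and n the number of earlier coordinates, the union
bound is C√(Λp · log(2M)), where log(2M) = log 2 + n log(2m+1) + ηp/Λ. Multiplied by Λ, the three
terms are small for different reasons: Λ ≤ θᵏτS, the gaps give nΛ ≤ ∑ θ^(k - blk i) λᵢ, and η is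
small. The arithmetic-geometric inequality then makes the bound summable over blocks. -/
theorem exists_block_majorant (hφ : IsSubgaussianSystem C φ μ) (hC : 0 < C)
    (hlac : IsLacunary lam blk θ L τ S) (hm : 0 < m) (hT : ∀ t ∈ T, ∀ j, |t j| ≤ 1)
    (hθ : 0 < θ) (hL : 0 < L) (hτ : 0 ≤ τ) (hS : 0 ≤ S)
    {A K δ η : ℝ} (hA : 0 < A) (hK : 0 < K) (hδ : 0 < δ) (hη : 0 < η)
    (h1 : K / A + 1 / m < η / 2) (h2 : K / A + 1 / m < Real.exp (-4) * δ ^ 2 / (8 * L)) (k : ℕ) :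
    ∃ H : Ω → ℝ, Integrable H μ ∧
      (∀ ω, ∀ t ∈ T, (∑ j with blk j = k, lam j * φ j ω * t j) -
        A * (tailMean lam blk m T k t - tailMean lam blk m T (k + 1) t) ≤ H ω) ∧
      ∫ ω, H ω ∂μ ≤ (1 / (4 * K) + δ + A / m + C * √η) * (∑ j with blk j = k, lam j) +
        C / 2 * √τ * (θ ^ k * S + ∑ j with blk j = k, lam j) +
        C / 2 * √(θ * Real.log (2 * m + 1)) * ((∑ j with blk j = k, lam j) +
          (∑ i with blk i < k, θ ^ (k - blk i) * lam i) / θ) := by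
  have hm' : (0 : ℝ) < m := by exact_mod_cast hm
  have hlam : ∀ j, 0 ≤ lam j := fun j => (hlac.pos j).le
  set B := Finset.univ.filter fun j => blk j = k with hB
  set p := ∑ j ∈ B, lam j with hp
  set Q := ∑ i with blk i < k, θ ^ (k - blk i) * lam i with hQ
  have hp0 : 0 ≤ p := Finset.sum_nonneg fun j _ => hlam j
  have hQ0 : 0 ≤ Q := Finset.sum_nonneg fun j _ => mul_nonneg (by positivity) (hlam j)
  rcases B.eq_empty_or_nonempty with hBe | hBne
  · have hpz : p = 0 := by rw [hp, hBe]; simp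
    refine ⟨fun _ => 0, integrable_const _, fun ω t ht => ?_, ?_⟩
    · have h := neg_le_tailMean_sub (lam := lam) (blk := blk) (k := k) hm hlam ht
      change -(p / m) ≤ _ at h
      rw [hpz, zero_div, neg_zero] at h
      rw [hBe, Finset.sum_empty, zero_sub, neg_nonpos]
      exact mul_nonneg hA.le h
    · rw [integral_zero]; positivity
  obtain ⟨j₀, hj₀, hmax⟩ := Finset.exists_max_image B lam hBne
  have hj₀k : blk j₀ = k := by simpa [hB] using hj₀
  set Λ := lam j₀ with hΛ
  have hΛ0 : 0 < Λ := hlac.pos j₀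
  have hpΛ : Λ ≤ p := Finset.single_le_sum (f := lam) (fun j _ => hlam j) hj₀
  have hp1 : 0 < p := hΛ0.trans_le hpΛ
  -- Chosen so that Λ * (y/2) = (η/2) * p, which `h1` compares with the drop threshold plus mesh
  -- error.
  set y := η * p / Λ with hy
  have hy0 : 0 ≤ y := by positivity
  set n := (Finset.univ.filter fun j => blk j < k).card with hn
  have e1 : K * p / A + p / m = (K / A + 1 / m) * p := by ring
  obtain ⟨N, hNT, hNcard, hNnet⟩ := exists_block_net (lam := lam) (blk := blk) (m := m) (T := T)
    hm hlam hT k (Λ := Λ) (L := L) (r := δ ^ 2 * p) (y := y) (v := K * p / A) hΛ0 hL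
    (by positivity) hy0 (fun j hj => hmax j (by simp [hB, hj]))
    (fun j hj => hlac.comparable j₀ j (hj₀k.trans hj.symm))
    (by
      change K * p / A + p / m < _
      rw [e1]
      calc _ < η / 2 * p := mul_lt_mul_of_pos_right h1 hp1
        _ = _ := by rw [hy]; field_simp)
    (by
      change K * p / A + p / m < _
      rw [e1]
      calc _ < Real.exp (-4) * δ ^ 2 / (8 * L) * p := mul_lt_mul_of_pos_right h2 hp1
        _ = _ := by ring)
  set M : ℝ := (2 * m + 1 : ℝ) ^ n * Real.exp y with hM
  have hM1 : 1 ≤ M := by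
    have : (1 : ℝ) ≤ (2 * m + 1 : ℝ) ^ n := one_le_pow₀ (by linarith)
    nlinarith [Real.one_le_exp hy0]
  -- On a block the coefficients λⱼsⱼ have squared ℓ² norm at most Λ * p.
  set D := C * √(Λ * p) with hD
  have hD0 : 0 < D := mul_pos hC (Real.sqrt_pos.2 (by positivity))
  classical
  set w : (ι → ℝ) → ι → ℝ := fun s j => if blk j = k then lam j * s j else 0 with hw
  have hwsum : ∀ (s : ι → ℝ) (ω : Ω),
      ∑ j, w s j * φ j ω = ∑ j ∈ B, lam j * φ j ω * s j := by
    intro s ω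
    simp only [hw, hB, ite_mul, zero_mul, Finset.sum_filter]
    exact Finset.sum_congr rfl fun j _ => by split_ifs <;> ring
  obtain ⟨U, hUint, hU0, hUle, hUI⟩ := hφ.exists_majorant (N.image w) (M := M) (D := D) hM1
    ((Nat.cast_le.2 Finset.card_image_le).trans hNcard) hD0 (by
      intro s' hs'
      obtain ⟨s, hs, rfl⟩ := Finset.mem_image.1 hs'
      refine mul_le_mul_of_nonneg_left (Real.sqrt_le_sqrt ?_) hC.le
      have : ∑ j, w s j ^ 2 = ∑ j ∈ B, (lam j * s j) ^ 2 := by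
        simp only [hw, hB, Finset.sum_filter]
        exact Finset.sum_congr rfl fun j _ => by split_ifs <;> simp
      rw [this, hp, Finset.mul_sum]
      refine Finset.sum_le_sum fun j hj => ?_
      have hs1 : s j ^ 2 ≤ 1 := by
        rw [← sq_abs]; exact pow_le_one₀ (abs_nonneg _) (hT s (hNT hs) j)
      calc (lam j * s j) ^ 2 = lam j * lam j * s j ^ 2 := by ring
        _ ≤ lam j * lam j * 1 := mul_le_mul_of_nonneg_left hs1 (mul_nonneg (hlam j) (hlam j))
        _ ≤ Λ * lam j := by
          rw [mul_one]; exact mul_le_mul_of_nonneg_right (hmax j hj) (hlam j))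
  have hsqint : Integrable (fun ω => ∑ j ∈ B, lam j * φ j ω ^ 2) μ :=
    integrable_finsetSum _ fun j _ => (hφ.integrable_sq j).const_mul _
  have hsqle : ∫ ω, ∑ j ∈ B, lam j * φ j ω ^ 2 ∂μ ≤ p := by
    rw [integral_finsetSum _ fun j _ => (hφ.integrable_sq j).const_mul _]
    refine Finset.sum_le_sum fun j _ => ?_
    rw [integral_const_mul]
    exact mul_le_of_le_one_right (hlam j) (hφ.integral_sq_le j)
  refine ⟨fun ω => (1 / (4 * K) + δ / 2) * (∑ j ∈ B, lam j * φ j ω ^ 2) +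
      (δ / 2 + A / m) * p + U ω,
    ((hsqint.const_mul _).add (integrable_const _)).add hUint, fun ω t ht => ?_, ?_⟩
  · refine block_contribution_le hm hlam hT k hA hK hδ (hU0 ω) hNnet (fun j => φ j ω) ?_ ht
    intro s hs
    have := hUle ω (w s) (Finset.mem_image_of_mem w hs)
    rwa [hwsum] at this
  · have hint : Integrable (fun ω => (1 / (4 * K) + δ / 2) * (∑ j ∈ B, lam j * φ j ω ^ 2) +
        (δ / 2 + A / m) * p) μ := (hsqint.const_mul _).add (integrable_const _)
    rw [integral_add hint hUint, integral_add (hsqint.const_mul _) (integrable_const _), integral_const_mul]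
    simp only [integral_const, probReal_univ, one_smul]
    have hmain : D * √(Real.log (2 * M)) ≤ C * √η * p + C / 2 * √τ * (θ ^ k * S + p) +
        C / 2 * √(θ * Real.log (2 * m + 1)) * (p + Q / θ) := by
      have hlogm : 0 ≤ Real.log (2 * m + 1) := Real.log_nonneg (by linarith)
      have hlogM : Real.log (2 * M) = Real.log 2 + n * Real.log (2 * m + 1) + y := by
        rw [hM, Real.log_mul (by norm_num) (by positivity), Real.log_mul (by positivity)
          (Real.exp_pos _).ne', Real.log_pow, Real.log_exp]; ring
      have hnΛ : n * Λ ≤ Q := by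
        rw [hn, hQ, ← nsmul_eq_mul, ← Finset.sum_const]
        refine Finset.sum_le_sum fun i hi => ?_
        have hi' : blk i < blk j₀ := by rw [hj₀k]; simpa using hi
        have := hlac.gap i j₀ hi'
        rwa [hj₀k] at this
      have hΛτ : Λ ≤ θ ^ k * (τ * S) := by
        have := hlac.small j₀
        rwa [hj₀k] at this
      have hlog2 : Real.log 2 ≤ 1 := by linarith [Real.log_two_lt_d9]
      have hle : Λ * p * Real.log (2 * M) ≤ τ * ((θ ^ k * S) * p) +
          θ * Real.log (2 * m + 1) * (p * (Q / θ)) + η * p ^ 2 := by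
        have t1 : Λ * p * Real.log 2 ≤ τ * ((θ ^ k * S) * p) := by
          calc Λ * p * Real.log 2 ≤ Λ * p * 1 := by gcongr
            _ ≤ θ ^ k * (τ * S) * p := by rw [mul_one]; gcongr
            _ = _ := by ring
        have t2 : Λ * p * (n * Real.log (2 * m + 1)) ≤
            θ * Real.log (2 * m + 1) * (p * (Q / θ)) := by
          calc _ = (n * Λ) * (p * Real.log (2 * m + 1)) := by ring
            _ ≤ Q * (p * Real.log (2 * m + 1)) := by gcongr
            _ = _ := by field_simp
        have t3 : Λ * p * y = η * p ^ 2 := by rw [hy]; field_simp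
        rw [hlogM, mul_add, mul_add, t3]
        linarith
      have hsq : √(Λ * p) * √(Real.log (2 * M)) ≤ 1 / 2 * √τ * (θ ^ k * S + p) +
          1 / 2 * √(θ * Real.log (2 * m + 1)) * (p + Q / θ) + √η * p := by
        rw [← Real.sqrt_mul (by positivity)]
        refine (Real.sqrt_le_sqrt hle).trans ((sqrt_add_three_le (by positivity) (by positivity)
          (by positivity)).trans (add_le_add (add_le_add ?_ ?_) ?_))
        · exact sqrt_mul_le_half (by positivity) hp0 hτ
        · exact sqrt_mul_le_half hp0 (by positivity) (by positivity)
        · rw [Real.sqrt_mul hη.le, Real.sqrt_sq hp0]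
      calc D * √(Real.log (2 * M)) = C * (√(Λ * p) * √(Real.log (2 * M))) := by rw [hD]; ring
        _ ≤ C * _ := mul_le_mul_of_nonneg_left hsq hC.le
        _ = _ := by ring
    have h3 : (1 / (4 * K) + δ / 2) * ∫ ω, ∑ j ∈ B, lam j * φ j ω ^ 2 ∂μ ≤
        (1 / (4 * K) + δ / 2) * p := mul_le_mul_of_nonneg_left hsqle (by positivity)
    linarith

theorem sum_geometric_le {θ : ℝ} (hθ : 0 ≤ θ) (hθ2 : θ ≤ 1 / 2) (n : ℕ) :
    ∑ k ∈ Finset.range n, θ ^ k ≤ 2 := by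
  calc ∑ k ∈ Finset.range n, θ ^ k ≤ ∑ k ∈ Finset.range n, (1 / 2 : ℝ) ^ k :=
        Finset.sum_le_sum fun k _ => pow_le_pow_left₀ hθ hθ2 k
    _ ≤ ∑' k : ℕ, (1 / 2 : ℝ) ^ k :=
        Summable.sum_le_tsum _ (fun k _ => by positivity) summable_geometric_two
    _ = 2 := tsum_geometric_two

/-- Comparison of a subgaussian system with signs for weights split into lacunary blocks. -/
theorem exists_majorant_of_isLacunary (hφ : IsSubgaussianSystem C φ μ) (hC : 0 < C)
    (hlac : IsLacunary lam blk θ L τ S) (hm : 0 < m) (hT : ∀ t ∈ T, ∀ j, |t j| ≤ 1)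
    (hθ : 0 < θ) (hθ2 : θ ≤ 1 / 2) (hL : 0 < L) (hτ : 0 ≤ τ) (hS : 0 ≤ S)
    {A K δ η : ℝ} (hA : 0 < A) (hK : 0 < K) (hδ : 0 < δ) (hη : 0 < η)
    (h1 : K / A + 1 / m < η / 2) (h2 : K / A + 1 / m < Real.exp (-4) * δ ^ 2 / (8 * L)) :
    ∃ H : Ω → ℝ, Integrable H μ ∧
      (∀ ω, ∀ t ∈ T, ∑ j, lam j * φ j ω * t j ≤
        A * 𝔼 ε, finsetMax T (signSum lam Finset.univ ε) + H ω) ∧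
      ∫ ω, H ω ∂μ ≤ (1 / (4 * K) + δ + A / m + C * √η + 3 / 2 * C * √τ +
        3 / 2 * C * √(θ * Real.log (2 * m + 1))) * S := by
  choose H hHint hH hHle using exists_block_majorant (T := T) hφ hC hlac hm hT hθ hL hτ hS hA hK hδ
    hη h1 h2
  obtain ⟨n, hn⟩ : ∃ n, ∀ j, blk j < n :=
    ⟨Finset.univ.sup blk + 1, fun j => Nat.lt_succ_of_le (Finset.le_sup (Finset.mem_univ j))⟩
  refine ⟨fun ω => ∑ k ∈ Finset.range n, H k ω, integrable_finsetSum _ fun k _ => hHint k,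
    fun ω t ht => sum_le_tailMean_add hn (fun k => H k ω) (fun j => φ j ω) ht
      fun k _ => hH k ω t ht, ?_⟩
  have hlam : ∀ j, 0 ≤ lam j := fun j => (hlac.pos j).le
  have hps : ∑ k ∈ Finset.range n, ∑ j with blk j = k, lam j ≤ S := by
    rw [Finset.sum_fiberwise_of_maps_to fun j _ => Finset.mem_range.2 (hn j)]
    exact hlac.sum_le
  -- After exchanging the sums, each λᵢ carries θ^(k - blk i - 1) over later blocks k, a geometric
  -- series starting at 1; the division by θ is compensated by the √θ in front.
  have hQs : ∑ k ∈ Finset.range n, (∑ i with blk i < k, θ ^ (k - blk i) * lam i) / θ ≤ 2 * S := by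
    calc _ = ∑ i, lam i * ∑ k ∈ Finset.range n, (if blk i < k then θ ^ (k - blk i) / θ else 0) := by
          simp only [Finset.sum_filter, Finset.sum_div, Finset.mul_sum]
          rw [Finset.sum_comm]
          refine Finset.sum_congr rfl fun i _ => Finset.sum_congr rfl fun k _ => ?_
          split_ifs
          · ring
          · simp
      _ ≤ ∑ i, lam i * 2 := by
          refine Finset.sum_le_sum fun i _ => mul_le_mul_of_nonneg_left ?_ (hlam i)
          rw [← Finset.sum_filter]
          calc _ = ∑ k ∈ (Finset.range n).filter (fun k => blk i < k), θ ^ (k - blk i - 1) := by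
                refine Finset.sum_congr rfl fun k hk => ?_
                have hk' : blk i < k := (Finset.mem_filter.1 hk).2
                rw [div_eq_iff hθ.ne', ← pow_succ]
                congr 1; omega
            _ = ∑ d ∈ ((Finset.range n).filter (fun k => blk i < k)).image
                  (fun k => k - blk i - 1), θ ^ d := by
                rw [Finset.sum_image]
                intro x hx y hy hxy
                simp only [Finset.coe_filter, Set.mem_ofPred_eq] at hx hy hxy
                omega
            _ ≤ ∑ d ∈ Finset.range n, θ ^ d := by
                refine Finset.sum_le_sum_of_subset_of_nonneg (fun d hd => ?_)
                  fun d _ _ => by positivity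
                obtain ⟨k, hk, rfl⟩ := Finset.mem_image.1 hd
                simp only [Finset.mem_filter, Finset.mem_range] at hk ⊢
                omega
            _ ≤ 2 := sum_geometric_le hθ.le hθ2 n
      _ ≤ 2 * S := by
          rw [← Finset.sum_mul, mul_comm]
          exact mul_le_mul_of_nonneg_left hlac.sum_le (by norm_num)
  have hgs : ∑ k ∈ Finset.range n, θ ^ k * S ≤ 2 * S := by
    rw [← Finset.sum_mul]
    exact mul_le_mul_of_nonneg_right (sum_geometric_le hθ.le hθ2 n) hS
  have hm' : (0 : ℝ) < m := by exact_mod_cast hm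
  rw [integral_finsetSum _ fun k _ => hHint k]
  refine (Finset.sum_le_sum fun k _ => hHle k).trans ?_
  rw [Finset.sum_add_distrib, Finset.sum_add_distrib, ← Finset.mul_sum, ← Finset.mul_sum,
    ← Finset.mul_sum, Finset.sum_add_distrib, Finset.sum_add_distrib]
  have c1 := mul_le_mul_of_nonneg_left hps
    (show 0 ≤ 1 / (4 * K) + δ + A / m + C * √η by positivity)
  have c2 := mul_le_mul_of_nonneg_left (add_le_add hgs hps)
    (show 0 ≤ C / 2 * √τ by positivity)
  have c3 := mul_le_mul_of_nonneg_left (add_le_add hps hQs)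
    (show 0 ≤ C / 2 * √(θ * Real.log (2 * m + 1)) by positivity)
  linarith

end

/-! ### Arithmetic of levels with one residue class modulo q removed. -/

section Levels

variable {q s : ℕ}

/-- The shift by q - s moves the discarded residue to 0, so a kept level has remainder between 1 and
q - 1. -/
theorem block_index_spec (hs : s < q) {l : ℕ} (hl : l % q ≠ s) :
    ∃ ρ, 1 ≤ ρ ∧ ρ + 1 ≤ q ∧ l + (q - s) = q * ((l + (q - s)) / q) + ρ := by
  refine ⟨(l + (q - s)) % q, ?_, Nat.mod_lt _ (by omega), (Nat.div_add_mod _ _).symm⟩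
  rw [Nat.one_le_iff_ne_zero]
  intro h0
  obtain ⟨c, hc⟩ := Nat.dvd_of_mod_eq_zero h0
  obtain ⟨d, rfl⟩ : ∃ d, c = d + 1 := ⟨c - 1, by
    have : c ≠ 0 := by rintro rfl; omega
    omega⟩
  have : l = s + q * d := by rw [mul_add, mul_one] at hc; omega
  exact hl (by rw [this, Nat.add_mul_mod_self_left, Nat.mod_eq_of_lt hs])

/-- Passing to a later block skips a discarded level. The extra 1 matters: a level fixes a weight
only up to a factor θ, and the skipped level absorbs it. -/
theorem block_index_gap (hs : s < q) {l l' : ℕ} (hl : l % q ≠ s) (hl' : l' % q ≠ s)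
    (h : (l + (q - s)) / q < (l' + (q - s)) / q) :
    l + 1 + ((l' + (q - s)) / q - (l + (q - s)) / q) ≤ l' := by
  obtain ⟨ρ, h1, h2, h3⟩ := block_index_spec hs hl
  obtain ⟨ρ', h1', h2', h3'⟩ := block_index_spec hs hl'
  obtain ⟨d, hd⟩ := Nat.exists_eq_add_of_lt h
  set b := (l + (q - s)) / q
  rw [hd] at h3' ⊢
  have e : q * (b + d + 1) = q * b + q * d + q := by ring
  have : d ≤ q * d := Nat.le_mul_of_pos_left d (by omega)
  rw [e] at h3'
  omega

theorem block_index_comparable (hs : s < q) {l l' : ℕ} (hl : l % q ≠ s) (hl' : l' % q ≠ s)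
    (h : (l + (q - s)) / q = (l' + (q - s)) / q) : l' + 1 ≤ l + q := by
  obtain ⟨ρ, h1, h2, h3⟩ := block_index_spec hs hl
  obtain ⟨ρ', h1', h2', h3'⟩ := block_index_spec hs hl'
  rw [← h] at h3'
  omega

theorem block_index_le (hs : s < q) (hq : 2 ≤ q) {l : ℕ} (hl : l % q ≠ s) :
    (l + (q - s)) / q ≤ l := by
  obtain ⟨ρ, h1, h2, h3⟩ := block_index_spec hs hl
  by_contra! hcon
  have h4 : q * (l + 1) ≤ q * ((l + (q - s)) / q) := Nat.mul_le_mul_left q hcon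
  have h5 : 2 * l ≤ q * l := Nat.mul_le_mul_right l hq
  rw [mul_add, mul_one] at h4
  omega

end Levels

/-- After discarding large weights and a set of small total weight, the remaining weights split
into lacunary blocks. -/
theorem exists_lacunary_decomposition {ι : Type*} [Fintype ι] [DecidableEq ι] (lam : ι → ℝ)
    (hlam : ∀ j, 0 ≤ lam j) {θ τ : ℝ} (hθ : 0 < θ) (hθ1 : θ < 1) (hτ : 0 < τ) {q : ℕ}
    (hq : 2 ≤ q) (hS : 0 < ∑ j, lam j) :
    ∃ J D : Finset ι, (∀ j, j ∈ J ∨ j ∈ D ∨ τ * ∑ i, lam i < lam j) ∧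
      ∑ j ∈ D, lam j ≤ (∑ j, lam j) / q ∧
      ∃ blk : J → ℕ, IsLacunary (fun j : J => lam j) blk θ ((1 / θ) ^ q) τ (∑ j, lam j) := by
  set S := ∑ j, lam j with hSdef
  have hτS : 0 < τ * S := mul_pos hτ hS
  have hlev : ∀ j, ∃ l : ℕ, 0 < lam j → lam j ≤ τ * S →
      θ ^ (l + 1) * (τ * S) < lam j ∧ lam j ≤ θ ^ l * (τ * S) := by
    intro j
    by_cases h : 0 < lam j ∧ lam j ≤ τ * S
    · obtain ⟨l, h1, h2⟩ := exists_nat_pow_near_of_lt_one (div_pos h.1 hτS)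
        ((div_le_one hτS).2 h.2) hθ hθ1
      exact ⟨l, fun _ _ => ⟨(lt_div_iff₀ hτS).1 h1, (div_le_iff₀ hτS).1 h2⟩⟩
    · exact ⟨0, fun h1 h2 => absurd ⟨h1, h2⟩ h⟩
  choose lev hlev using hlev
  have hq0 : (0 : ℝ) < q := by exact_mod_cast (by omega : 0 < q)
  -- Pigeonhole over the q residue classes of levels.
  obtain ⟨s, hs, hsmass⟩ : ∃ s ∈ Finset.range q, ∑ j with lev j % q = s, lam j ≤ S / q := by
    refine Finset.exists_le_of_sum_le (Finset.nonempty_range_iff.2 (by omega)) (le_of_eq ?_)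
    rw [Finset.sum_fiberwise_of_maps_to
      fun j _ => Finset.mem_range.2 (Nat.mod_lt _ (by omega))]
    simp only [Finset.sum_const, Finset.card_range, nsmul_eq_mul]
    rw [mul_div_cancel₀ _ hq0.ne']
  have hsq : s < q := Finset.mem_range.1 hs
  set J := Finset.univ.filter fun j => 0 < lam j ∧ lam j ≤ τ * S ∧ lev j % q ≠ s with hJ
  -- Zero weights have no meaningful level; placing them here completes the cover at no cost in
  -- mass.
  set D := Finset.univ.filter fun j => lev j % q = s ∨ lam j = 0 with hD
  have hJm : ∀ j : J, 0 < lam j ∧ lam j ≤ τ * S ∧ lev j % q ≠ s := fun j =>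
    (Finset.mem_filter.1 j.2).2
  have hJlev := fun j : J => hlev j (hJm j).1 (hJm j).2.1
  refine ⟨J, D, fun j => ?_, ?_, fun j => (lev j + (q - s)) / q, ?_⟩
  · simp only [hJ, hD, Finset.mem_filter, Finset.mem_univ, true_and]
    by_contra! h
    exact h.2.1.1 (h.1 ((hlam j).lt_of_ne' h.2.1.2) h.2.2)
  · refine le_trans (le_of_eq ?_) hsmass
    symm
    refine Finset.sum_subset (fun j hj => ?_) fun j hj hj' => ?_
    · simp only [hD, Finset.mem_filter, Finset.mem_univ, true_and] at hj ⊢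
      exact Or.inl hj
    · simp only [hD, Finset.mem_filter, Finset.mem_univ, true_and] at hj hj'
      exact hj.resolve_left hj'
  · refine ⟨fun j => (hJm j).1, fun i j h => ?_, fun i j h => ?_, fun j => ?_, ?_⟩
    · have hg := block_index_gap hsq (hJm i).2.2 (hJm j).2.2 h
      set d := (lev j + (q - s)) / q - (lev i + (q - s)) / q
      calc lam j ≤ θ ^ lev j * (τ * S) := (hJlev j).2
        _ ≤ θ ^ (lev i + 1 + d) * (τ * S) :=
          mul_le_mul_of_nonneg_right (pow_le_pow_of_le_one hθ.le hθ1.le hg) hτS.le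
        _ = θ ^ d * (θ ^ (lev i + 1) * (τ * S)) := by rw [pow_add]; ring
        _ ≤ θ ^ d * lam i := mul_le_mul_of_nonneg_left (hJlev i).1.le (by positivity)
    · have hg := block_index_comparable hsq (hJm i).2.2 (hJm j).2.2 h
      rw [one_div, inv_pow, inv_mul_eq_div, le_div_iff₀ (by positivity)]
      calc lam i * θ ^ q ≤ θ ^ lev i * (τ * S) * θ ^ q :=
            mul_le_mul_of_nonneg_right (hJlev i).2 (by positivity)
        _ = θ ^ (lev i + q) * (τ * S) := by rw [pow_add]; ring
        _ ≤ θ ^ (lev j + 1) * (τ * S) :=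
          mul_le_mul_of_nonneg_right (pow_le_pow_of_le_one hθ.le hθ1.le hg) hτS.le
        _ ≤ lam j := (hJlev j).1.le
    · exact (hJlev j).2.trans (mul_le_mul_of_nonneg_right
        (pow_le_pow_of_le_one hθ.le hθ1.le (block_index_le hsq hq (hJm j).2.2)) hτS.le)
    · rw [Finset.sum_coe_sort J lam]
      exact Finset.sum_le_sum_of_subset_of_nonneg (Finset.subset_univ _) fun j _ _ => hlam j

/-! ### Norming functionals and monotonicity of Rademacher averages. -/

section Norm

variable {ι X : Type*} [Fintype ι] [NormedAddCommGroup X] [NormedSpace ℝ X]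

/-- The norm of linear combinations of finitely many vectors is approximated by finitely many
functionals. -/
theorem exists_norming_finset (x : ι → X) (hx : ∀ j, ‖x j‖ ≤ 1) (lam : ι → ℝ)
    (hlam : ∀ j, 0 ≤ lam j) {m : ℕ} (hm : 0 < m) :
    ∃ T : Finset (ι → ℝ), T.Nonempty ∧ (∀ t ∈ T, ∀ j, |t j| ≤ 1) ∧
      (∀ b : ι → ℝ, ∀ t ∈ T, ∑ j, lam j * b j * t j ≤ ‖∑ j, (lam j * b j) • x j‖) ∧
      ∀ b : ι → ℝ, ∃ t ∈ T, ‖∑ j, (lam j * b j) • x j‖ ≤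
        ∑ j, lam j * b j * t j + (1 / m) * ∑ j, lam j * |b j| := by
  classical
  have hm' : (0 : ℝ) < m := by exact_mod_cast hm
  set F : Set (StrongDual ℝ X) := {f | ‖f‖ ≤ 1} with hF
  set code : StrongDual ℝ X → ι → ℤ := fun f j => ⌊(m : ℝ) * f (x j)⌋ with hcode
  have hval : ∀ f ∈ F, ∀ j, |f (x j)| ≤ 1 := fun f hf j => by
    calc |f (x j)| ≤ ‖f‖ * ‖x j‖ := f.le_opNorm (x j)
      _ ≤ 1 := mul_le_one₀ hf (norm_nonneg _) (hx j)
  have hfin : (code '' F).Finite := by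
    refine (Fintype.piFinset fun _ : ι => Finset.Icc (-(m : ℤ)) m).finite_toSet.subset ?_
    rintro _ ⟨f, hf, rfl⟩
    rw [Finset.mem_coe, Fintype.mem_piFinset]
    intro j
    have hb := abs_le.1 (hval f hf j)
    simp only [hcode]
    rw [Finset.mem_Icc, Int.le_floor, Int.floor_le_iff]
    push_cast
    constructor <;> nlinarith
  -- One functional is kept per code; functionals with equal codes differ by less than 1/m on every
  -- x j.
  obtain ⟨F', hF', hbij⟩ := Set.exists_subset_bijOn F code
  have hF'fin : F'.Finite := hbij.finite_iff_finite.2 hfin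
  have happ : ∀ (f : StrongDual ℝ X) (b : ι → ℝ),
      f (∑ j, (lam j * b j) • x j) = ∑ j, lam j * b j * f (x j) := fun f b => by
    simp [map_sum, map_smul, smul_eq_mul]
  have hnet : ∀ f ∈ F, ∃ g ∈ F', ∀ j, |f (x j) - g (x j)| ≤ 1 / m := by
    intro f hf
    obtain ⟨g, hg, hgc⟩ := hbij.surjOn (Set.mem_image_of_mem code hf)
    refine ⟨g, hg, fun j => ?_⟩
    have := Int.abs_sub_lt_one_of_floor_eq_floor (congrFun hgc.symm j)
    rw [← mul_sub, abs_mul, abs_of_pos hm'] at this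
    rw [le_div_iff₀ hm']
    linarith
  refine ⟨hF'fin.toFinset.image fun f j => f (x j), ?_, ?_, ?_, ?_⟩
  · obtain ⟨g, hg, -⟩ := hnet 0 (by simp [hF])
    exact ⟨_, Finset.mem_image_of_mem _ (hF'fin.mem_toFinset.2 hg)⟩
  · intro t ht j
    obtain ⟨f, hf, rfl⟩ := Finset.mem_image.1 ht
    exact hval f (hF' (hF'fin.mem_toFinset.1 hf)) j
  · intro b t ht
    obtain ⟨f, hf, rfl⟩ := Finset.mem_image.1 ht
    rw [← happ f b]
    calc f (∑ j, (lam j * b j) • x j) ≤ |f (∑ j, (lam j * b j) • x j)| := le_abs_self _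
      _ ≤ ‖f‖ * ‖∑ j, (lam j * b j) • x j‖ := f.le_opNorm _
      _ ≤ 1 * ‖∑ j, (lam j * b j) • x j‖ :=
        mul_le_mul_of_nonneg_right (hF' (hF'fin.mem_toFinset.1 hf)) (norm_nonneg _)
      _ = _ := one_mul _
  · intro b
    obtain ⟨f, hf1, hf2⟩ := exists_dual_vector'' ℝ (∑ j, (lam j * b j) • x j)
    obtain ⟨g, hg, hfg⟩ := hnet f hf1
    refine ⟨_, Finset.mem_image_of_mem _ (hF'fin.mem_toFinset.2 hg), ?_⟩
    have hf3 : ‖∑ j, (lam j * b j) • x j‖ = ∑ j, lam j * b j * f (x j) := by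
      rw [← happ, hf2]; rfl
    rw [hf3, Finset.mul_sum, ← Finset.sum_add_distrib]
    refine Finset.sum_le_sum fun j _ => ?_
    have : lam j * b j * (f (x j) - g (x j)) ≤ 1 / m * (lam j * |b j|) := by
      calc _ ≤ |lam j * b j * (f (x j) - g (x j))| := le_abs_self _
        _ = lam j * |b j| * |f (x j) - g (x j)| := by
          rw [abs_mul, abs_mul, abs_of_nonneg (hlam j)]
        _ ≤ lam j * |b j| * (1 / m) :=
          mul_le_mul_of_nonneg_left (hfg j) (mul_nonneg (hlam j) (abs_nonneg _))
        _ = _ := by ring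
    linarith

variable [DecidableEq ι]

/-- Rademacher averages decrease when coordinates are dropped. -/
theorem expect_norm_subset_le (J : Finset ι) (y : ι → X) :
    𝔼 ε : ι → Bool, ‖∑ j ∈ J, boolSign (ε j) • y j‖ ≤
      𝔼 ε : ι → Bool, ‖∑ j, boolSign (ε j) • y j‖ := by
  -- Flipping the signs outside J preserves the average, and the mean of the original and flipped
  -- sums is the sum over J.
  let e : (ι → Bool) ≃ (ι → Bool) :=
    Equiv.piCongrRight fun j => if j ∈ J then Equiv.refl _ else Equiv.boolNot
  have he : 𝔼 ε : ι → Bool, ‖∑ j, boolSign (e ε j) • y j‖ =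
      𝔼 ε : ι → Bool, ‖∑ j, boolSign (ε j) • y j‖ :=
    Fintype.expect_equiv e _ _ fun ε => rfl
  have hkey : ∀ ε : ι → Bool, ‖∑ j ∈ J, boolSign (ε j) • y j‖ ≤
      (1 / 2) * (‖∑ j, boolSign (ε j) • y j‖ + ‖∑ j, boolSign (e ε j) • y j‖) := by
    intro ε
    have h : ∑ j ∈ J, boolSign (ε j) • y j = (1 / 2 : ℝ) •
        (∑ j, boolSign (ε j) • y j + ∑ j, boolSign (e ε j) • y j) := by
      rw [← Finset.sum_add_distrib, Finset.smul_sum, ← Finset.sum_subset (Finset.subset_univ J)]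
      · refine Finset.sum_congr rfl fun j hj => ?_
        have : e ε j = ε j := by simp [e, hj]
        rw [this, ← add_smul, smul_smul]
        congr 1; ring
      · intro j _ hj
        have : e ε j = !ε j := by simp [e, hj]
        rw [this, boolSign_not, neg_smul, add_neg_cancel, smul_zero]
    rw [h, norm_smul, Real.norm_of_nonneg (by norm_num)]
    exact mul_le_mul_of_nonneg_left (norm_add_le _ _) (by norm_num)
  calc _ ≤ 𝔼 ε : ι → Bool, (1 / 2) *
        (‖∑ j, boolSign (ε j) • y j‖ + ‖∑ j, boolSign (e ε j) • y j‖) :=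
        Finset.expect_le_expect fun ε _ => hkey ε
    _ = _ := by
        rw [← Finset.mul_expect, Finset.expect_add_distrib, he]; ring

theorem expect_restrict_signs (J : Finset ι) (F : (J → Bool) → ℝ) :
    𝔼 ε : ι → Bool, F (fun j => ε j) = 𝔼 ε, F ε := by
  have h := Fintype.expect_equiv (Equiv.piEquivPiSubtypeProd (· ∈ J) fun _ : ι => Bool)
    (fun ε : ι → Bool => F fun j => ε j) (fun p => F p.1) fun ε => rfl
  rw [h, ← Finset.univ_product_univ, Finset.expect_product]
  simp

/-- All coordinates but one are dropped. This is what controls the exceptional large weights. -/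
theorem norm_le_expect_norm (y : ι → X) (i : ι) :
    ‖y i‖ ≤ 𝔼 ε : ι → Bool, ‖∑ j, boolSign (ε j) • y j‖ := by
  refine le_trans (le_of_eq ?_) (expect_norm_subset_le {i} y)
  simp [norm_smul, abs_boolSign]

end Norm

/-! ### Choice of parameters. -/

/-- The choice of parameters in the comparison theorem. -/
theorem exists_parameters {C e : ℝ} (hC : 0 < C) (he : 0 < e) :
    ∃ (τ θ A K δ η : ℝ) (q m : ℕ), 0 < τ ∧ 0 < θ ∧ θ ≤ 1 / 2 ∧ 0 < A ∧ 0 < K ∧ 0 < δ ∧ 0 < η ∧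
      2 ≤ q ∧ 1 / (q : ℝ) ≤ e ∧ 0 < m ∧ 1 / (m : ℝ) ≤ e ∧ K / A + 1 / m < η / 2 ∧
      K / A + 1 / m < Real.exp (-4) * δ ^ 2 / (8 * (1 / θ) ^ q) ∧
      1 / (4 * K) + δ + A / m + C * √η + 3 / 2 * C * √τ +
        3 / 2 * C * √(θ * Real.log (2 * m + 1)) ≤ 6 * e := by
  set K := 1 / (4 * e) with hK
  set η := (e / C) ^ 2 with hη
  set τ := (e / (2 * C)) ^ 2 with hτ
  set q : ℕ := ⌈1 / e⌉₊ + 2 with hq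
  set g₀ := min (η / 2) (Real.exp (-4) * e ^ 2 / 8) with hg₀
  have hg₀0 : 0 < g₀ := by positivity
  -- The three summands secure, through m ≥ B * L, the bounds 1/m ≤ g/4, A/m ≤ e and 1/m ≤ e, where
  -- A = 4K/g and g = g₀/L is below both thresholds.
  set B := 4 / g₀ + 4 * K / (g₀ * e) + 1 / e with hB
  have hB0 : 0 < B := by positivity
  set c := Real.log (2 * B + 3) with hc
  have hc0 : 0 ≤ c := Real.log_nonneg (by linarith)
  -- The requirement θ log(2m+1) ≤ τ looks circular, since m is of order θ^(-q). But log m grows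
  -- only like q log(1/θ), and with θ = ρ² the product is at most ρ(c + 2q).
  set ρ := min (1 / 2) (τ / (c + 2 * q)) with hρ
  have hq2 : (2 : ℝ) ≤ q := by rw [hq]; push_cast; linarith [Nat.cast_nonneg (α := ℝ) ⌈1 / e⌉₊]
  have hρ0 : 0 < ρ := by positivity
  have hρ2 : ρ ≤ 1 / 2 := min_le_left _ _
  have hρτ : ρ * (c + 2 * q) ≤ τ := by
    rw [← le_div_iff₀ (by positivity)]; exact min_le_right _ _
  set θ := ρ ^ 2 with hθ
  have hθ0 : 0 < θ := by positivity
  have hθ2 : θ ≤ 1 / 2 := by nlinarith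
  set g := g₀ * θ ^ q with hg
  have hg0 : 0 < g := by positivity
  have hθq : θ ^ q ≤ 1 := pow_le_one₀ hθ0.le (by linarith)
  have hgg : g ≤ g₀ := mul_le_of_le_one_right hg₀0.le hθq
  set L := (1 / θ) ^ q with hL
  have hL1 : 1 ≤ L := one_le_pow₀ (by rw [le_div_iff₀ hθ0]; linarith)
  have hLθ : L * θ ^ q = 1 := by rw [hL, ← mul_pow, one_div, inv_mul_cancel₀ hθ0.ne', one_pow]
  set m : ℕ := ⌈B * L⌉₊ with hm
  have hmB : B * L ≤ m := Nat.le_ceil _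
  have hm0 : (0 : ℝ) < m := lt_of_lt_of_le (by positivity) hmB
  have hgL : g * L = g₀ := by rw [hg, mul_assoc, mul_comm _ L, hLθ, mul_one]
  have hm1 : 1 / (m : ℝ) ≤ g / 4 := by
    rw [div_le_iff₀ hm0]
    have h1 : 4 / g₀ * L ≤ m := le_trans (mul_le_mul_of_nonneg_right
      (by rw [hB]; have : 0 < 4 * K / (g₀ * e) + 1 / e := by positivity
          linarith) (by linarith)) hmB
    calc (1 : ℝ) = g / 4 * (4 / g₀ * L) := by rw [← hgL]; field_simp
      _ ≤ _ := mul_le_mul_of_nonneg_left h1 (by positivity)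
  have hme : 1 / (m : ℝ) ≤ e := by
    rw [div_le_iff₀ hm0]
    have h1 : 1 / e ≤ m := by
      have : 1 / e ≤ B := by
        rw [hB]; have : 0 < 4 / g₀ + 4 * K / (g₀ * e) := by positivity
        linarith
      nlinarith
    calc (1 : ℝ) = e * (1 / e) := by field_simp
      _ ≤ _ := mul_le_mul_of_nonneg_left h1 he.le
  have hAm : 4 * K / g / m ≤ e := by
    rw [div_le_iff₀ hm0]
    have h1 : 4 * K / (g₀ * e) * L ≤ m := le_trans (mul_le_mul_of_nonneg_right
      (by rw [hB]; have h1 : 0 < 4 / g₀ := by positivity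
          have h2 : 0 < 1 / e := by positivity
          linarith) (by linarith)) hmB
    calc 4 * K / g = e * (4 * K / (g₀ * e) * L) := by rw [← hgL]; field_simp
      _ ≤ _ := mul_le_mul_of_nonneg_left h1 he.le
  have hKA : K / (4 * K / g) + 1 / m < g := by
    have : K / (4 * K / g) = g / 4 := by
      have hK0 : K ≠ 0 := by positivity
      field_simp
    linarith
  refine ⟨τ, θ, 4 * K / g, K, e, η, q, m, by positivity, hθ0, hθ2, by positivity, by positivity, he,
    by positivity, by omega, ?_, by exact_mod_cast hm0, hme, ?_, ?_, ?_⟩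
  · have : 1 / e ≤ q := by
      rw [hq]; push_cast; linarith [Nat.le_ceil (1 / e)]
    rw [div_le_iff₀ (by linarith)]
    calc (1 : ℝ) = e * (1 / e) := by field_simp
      _ ≤ _ := mul_le_mul_of_nonneg_left this he.le
  · exact hKA.trans_le (hgg.trans (min_le_left _ _))
  · refine hKA.trans_le ?_
    have h1 : g₀ ≤ Real.exp (-4) * e ^ 2 / 8 := min_le_right _ _
    rw [le_div_iff₀ (by positivity)]
    calc g * (8 * L) = 8 * g₀ := by rw [← hgL]; ring
      _ ≤ _ := by linarith
  · have h1 : 1 / (4 * K) = e := by rw [hK]; field_simp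
    have h2 : C * √η = e := by rw [hη, Real.sqrt_sq (by positivity)]; field_simp
    have h3 : C * √τ = e / 2 := by rw [hτ, Real.sqrt_sq (by positivity)]; field_simp
    have hlog : Real.log (2 * m + 1) ≤ c + q * (2 / ρ) := by
      have hmle : (m : ℝ) ≤ B * L + 1 := (Nat.ceil_lt_add_one (by positivity)).le
      have h4 : (2 * m + 1 : ℝ) ≤ (2 * B + 3) * L := by nlinarith
      calc Real.log (2 * m + 1) ≤ Real.log ((2 * B + 3) * L) :=
            Real.log_le_log (by linarith) h4
        _ = c + q * Real.log (1 / θ) := by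
          rw [Real.log_mul (by positivity) (by positivity), hL, Real.log_pow]
        _ = c + q * (2 * Real.log (1 / ρ)) := by
          congr 2
          rw [hθ, ← one_div_pow, Real.log_pow]; norm_num
        _ ≤ c + q * (2 * (1 / ρ)) := by
          have := Real.log_le_self (show 0 ≤ 1 / ρ by positivity)
          gcongr
        _ = _ := by ring
    have h5 : θ * Real.log (2 * m + 1) ≤ τ := by
      calc θ * Real.log (2 * m + 1) ≤ θ * (c + q * (2 / ρ)) :=
            mul_le_mul_of_nonneg_left hlog hθ0.le
        _ = ρ * (ρ * c + 2 * q) := by rw [hθ]; field_simp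
        _ ≤ ρ * (c + 2 * q) := by
          have : ρ * c ≤ c := mul_le_of_le_one_left hc0 (by linarith)
          gcongr
        _ ≤ τ := hρτ
    have h6 : C * √(θ * Real.log (2 * m + 1)) ≤ e / 2 :=
      (mul_le_mul_of_nonneg_left (Real.sqrt_le_sqrt h5) hC.le).trans_eq h3
    rw [h1, h2]
    linarith

/-! ### Comparison for arbitrary weights. -/

/-- Norms of subgaussian sums are dominated by Rademacher averages up to a small multiple of the
total weight. -/
theorem exists_majorant_norm {C ε : ℝ} (hC : 0 < C) (hε : 0 < ε) :
    ∃ A : ℝ, 0 < A ∧ ∀ (ι Ω X : Type*) [Fintype ι] [DecidableEq ι] [MeasurableSpace Ω]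
      (μ : Measure Ω) [IsProbabilityMeasure μ] [NormedAddCommGroup X] [NormedSpace ℝ X]
      (φ : ι → Ω → ℝ) (x : ι → X) (lam : ι → ℝ), IsSubgaussianSystem C φ μ →
      (∀ j, ‖x j‖ ≤ 1) → (∀ j, 0 ≤ lam j) →
      ∃ G : Ω → ℝ, Integrable G μ ∧ (∀ ω, ‖∑ j, (lam j * φ j ω) • x j‖ ≤ G ω) ∧
        ∫ ω, G ω ∂μ ≤ A * 𝔼 σ : ι → Bool, ‖∑ j, (lam j * boolSign (σ j)) • x j‖ +
          ε * ∑ j, lam j := by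
  -- Of the eight shares ε/8, six go to the lacunary part, one to discretising the norm and one to
  -- the discarded levels.
  obtain ⟨τ, θ, A, K, δ, η, q, m, hτ, hθ, hθ2, hA, hK, hδ, hη, hq, hqe, hm, hme, h1, h2, hsum⟩ :=
    exists_parameters hC (show 0 < ε / 8 by positivity)
  -- The extra 1/τ bounds the number of weights above τS, each of which costs at most R.
  refine ⟨A + 1 / τ, by positivity, ?_⟩
  intro ι Ω X _ _ _ μ _ _ _ φ x lam hφ hx hlam
  set S := ∑ j, lam j with hS
  have hS0 : 0 ≤ S := Finset.sum_nonneg fun j _ => hlam j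
  set R := 𝔼 σ : ι → Bool, ‖∑ j, (lam j * boolSign (σ j)) • x j‖ with hR
  have hRsmul : R = 𝔼 σ : ι → Bool, ‖∑ j, boolSign (σ j) • (lam j • x j)‖ := by
    refine Finset.expect_congr rfl fun σ _ => ?_
    congr 1
    exact Finset.sum_congr rfl fun j _ => by rw [smul_smul, mul_comm]
  rcases hS0.eq_or_lt with hSz | hSpos
  · have hz : ∀ j, lam j = 0 := fun j =>
      (Finset.sum_eq_zero_iff_of_nonneg fun j _ => hlam j).1 hSz.symm j (Finset.mem_univ j)
    refine ⟨fun _ => 0, integrable_const _, fun ω => by simp [hz], ?_⟩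
    rw [integral_zero, hR, ← hSz]
    simp [hz]
  obtain ⟨J, D, hcover, hDmass, blk, hlac⟩ :=
    exists_lacunary_decomposition lam hlam hθ (by linarith) hτ hq hSpos
  have hτS : 0 < τ * S := mul_pos hτ hSpos
  set E := Finset.univ.filter fun j => τ * S < lam j with hE
  have hEcard : (E.card : ℝ) ≤ 1 / τ := by
    have : E.card * (τ * S) ≤ S := by
      calc E.card * (τ * S) = ∑ _j ∈ E, τ * S := by simp
        _ ≤ ∑ j ∈ E, lam j := Finset.sum_le_sum fun j hj => (Finset.mem_filter.1 hj).2.le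
        _ ≤ S := Finset.sum_le_sum_of_subset_of_nonneg (Finset.subset_univ _) fun j _ _ => hlam j
    rw [le_div_iff₀ hτ]
    nlinarith
  -- the kept coordinates
  have hφJ : IsSubgaussianSystem C (fun j : J => φ j) μ := by
    have hext : ∀ (a : J → ℝ) (f : ι → ℝ → ℝ) (_ : ∀ j, f j 0 = 0),
        ∑ j, f j (if h : j ∈ J then a ⟨j, h⟩ else 0) = ∑ j : J, f j (a j) := by
      intro a f hf
      rw [← Finset.sum_subset (Finset.subset_univ J) fun j _ hj => by rw [dif_neg hj, hf],
        ← Finset.sum_coe_sort J]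
      exact Finset.sum_congr rfl fun j _ => by rw [dif_pos j.2]
    have h1 : ∀ a : J → ℝ, ∑ j, (if h : j ∈ J then a ⟨j, h⟩ else 0) ^ 2 = ∑ j, a j ^ 2 :=
      fun a => hext a (fun _ y => y ^ 2) fun _ => by norm_num
    have h2 : ∀ (a : J → ℝ) (ω : Ω), ∑ j, (if h : j ∈ J then a ⟨j, h⟩ else 0) * φ j ω =
        ∑ j : J, a j * φ j ω := fun a ω => hext a (fun j y => y * φ j ω) fun _ => zero_mul _
    refine ⟨fun j => hφ.aestronglyMeasurable j, fun j => hφ.integrable_sq j,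
      fun j => hφ.integral_sq_le j, fun a K hK hCK => ?_, fun a K hK hCK => ?_⟩
    · have := hφ.integrable_exp _ K hK (by rw [h1 a]; exact hCK)
      simpa only [h2] using this
    · have := hφ.integral_exp_le _ K hK (by rw [h1 a]; exact hCK)
      simpa only [h2] using this
  obtain ⟨T, hTne, hT1, hTle, hTge⟩ := exists_norming_finset (fun j : J => x j) (fun j => hx j)
    (fun j : J => lam j) (fun j => hlam j) hm
  obtain ⟨H, hHint, hH, hHle⟩ := exists_majorant_of_isLacunary hφJ hC hlac hm hT1 hθ hθ2
    (by positivity) hτ.le hSpos.le hA hK hδ hη h1 h2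
  have hRJ : 𝔼 σ, finsetMax T (signSum (fun j : J => lam j) Finset.univ σ) ≤ R := by
    calc _ ≤ 𝔼 σ : J → Bool, ‖∑ j : J, boolSign (σ j) • (lam j • x j)‖ := by
          refine Finset.expect_le_expect fun σ _ => finsetMax_le hTne fun t ht => ?_
          refine (hTle (fun j => boolSign (σ j)) t ht).trans (le_of_eq ?_)
          congr 1
          exact Finset.sum_congr rfl fun j _ => by rw [smul_smul, mul_comm]
      _ = 𝔼 σ : ι → Bool, ‖∑ j ∈ J, boolSign (σ j) • (lam j • x j)‖ := by
          rw [← expect_restrict_signs]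
          refine Finset.expect_congr rfl fun σ _ => ?_
          rw [← Finset.sum_coe_sort J]
      _ ≤ R := hRsmul ▸ expect_norm_subset_le J fun j => lam j • x j
  have habs : ∀ j, Integrable (fun ω => |φ j ω|) μ ∧ ∫ ω, |φ j ω| ∂μ ≤ 1 := by
    intro j
    have hb : ∀ ω, |φ j ω| ≤ 1 / 2 + 1 / 2 * φ j ω ^ 2 := fun ω => by
      nlinarith [sq_nonneg (|φ j ω| - 1), sq_abs (φ j ω)]
    have hint : Integrable (fun ω => 1 / 2 + 1 / 2 * φ j ω ^ 2) μ :=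
      (integrable_const _).add ((hφ.integrable_sq j).const_mul _)
    have hi : Integrable (fun ω => |φ j ω|) μ := by
      refine hint.mono' (hφ.aestronglyMeasurable j).norm (Filter.Eventually.of_forall fun ω => ?_)
      simpa using hb ω
    refine ⟨hi, (integral_mono hi hint hb).trans ?_⟩
    rw [integral_add (integrable_const _) ((hφ.integrable_sq j).const_mul _), integral_const_mul]
    simp only [integral_const, probReal_univ, one_smul]
    linarith [hφ.integral_sq_le j]
  have hwint : ∀ (c : ι → ℝ) (s : Finset ι), Integrable (fun ω => ∑ j ∈ s, c j * |φ j ω|) μ :=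
    fun c s => integrable_finsetSum _ fun j _ => (habs j).1.const_mul _
  have hwle : ∀ (c : ι → ℝ) (s : Finset ι), (∀ j, 0 ≤ c j) →
      ∫ ω, ∑ j ∈ s, c j * |φ j ω| ∂μ ≤ ∑ j ∈ s, c j := fun c s hc => by
    rw [integral_finsetSum _ fun j _ => (habs j).1.const_mul _]
    refine Finset.sum_le_sum fun j _ => ?_
    rw [integral_const_mul]
    exact mul_le_of_le_one_right (hc j) (habs j).2
  -- The factor ‖x j‖ is kept here: λⱼ‖xⱼ‖, unlike λⱼ alone, is bounded by R.
  set w : ι → ℝ := fun j => lam j * ‖x j‖ with hw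
  have hw0 : ∀ j, 0 ≤ w j := fun j => mul_nonneg (hlam j) (norm_nonneg _)
  have hwR : ∀ j, w j ≤ R := fun j => by
    rw [hRsmul]
    refine le_trans (le_of_eq ?_) (norm_le_expect_norm (fun j => lam j • x j) j)
    rw [norm_smul, Real.norm_of_nonneg (hlam j)]
  have hR0 : 0 ≤ R := Finset.expect_nonneg fun σ _ => norm_nonneg _
  have hpoint : ∀ ω, ‖∑ j, (lam j * φ j ω) • x j‖ ≤ (A * R + H ω) +
      (1 / m) * (∑ j, lam j * |φ j ω|) + ∑ j ∈ D, lam j * |φ j ω| + ∑ j ∈ E, w j * |φ j ω| := by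
    intro ω
    have hn : ∀ j, ‖(lam j * φ j ω) • x j‖ = w j * |φ j ω| := fun j => by
      rw [norm_smul, norm_mul, Real.norm_of_nonneg (hlam j), Real.norm_eq_abs]
      simp only [hw]; ring
    have hsplit : ∑ j, (lam j * φ j ω) • x j = ∑ j ∈ J, (lam j * φ j ω) • x j +
        ∑ j ∈ Jᶜ, (lam j * φ j ω) • x j := (Finset.sum_add_sum_compl J _).symm
    have hJc : ‖∑ j ∈ Jᶜ, (lam j * φ j ω) • x j‖ ≤
        ∑ j ∈ D, lam j * |φ j ω| + ∑ j ∈ E, w j * |φ j ω| := by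
      have hnn : ∀ j, 0 ≤ w j * |φ j ω| := fun j => mul_nonneg (hw0 j) (abs_nonneg _)
      calc _ ≤ ∑ j ∈ Jᶜ, w j * |φ j ω| := norm_sum_le_of_le _ fun j _ => (hn j).le
        _ ≤ ∑ j ∈ D ∪ E, w j * |φ j ω| := by
          refine Finset.sum_le_sum_of_subset_of_nonneg (fun j hj => ?_) fun j _ _ => hnn j
          rw [Finset.mem_compl] at hj
          rcases hcover j with h | h | h
          · exact absurd h hj
          · exact Finset.mem_union_left _ h
          · exact Finset.mem_union_right _ (by simpa [hE] using h)
        _ ≤ ∑ j ∈ D, w j * |φ j ω| + ∑ j ∈ E, w j * |φ j ω| := by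
          rw [← Finset.sum_union_inter]
          exact le_add_of_nonneg_right (Finset.sum_nonneg fun j _ => hnn j)
        _ ≤ _ := by
          gcongr with j
          exact mul_le_of_le_one_right (hlam j) (hx j)
    have hJ : ‖∑ j ∈ J, (lam j * φ j ω) • x j‖ ≤ A * R + H ω +
        (1 / m) * ∑ j, lam j * |φ j ω| := by
      obtain ⟨t, ht, hle⟩ := hTge fun j : J => φ j ω
      rw [← Finset.sum_coe_sort J]
      refine hle.trans (add_le_add ((hH ω t ht).trans ?_) ?_)
      · gcongr
      · refine mul_le_mul_of_nonneg_left ?_ (by positivity)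
        rw [Finset.sum_coe_sort J fun j => lam j * |φ j ω|]
        exact Finset.sum_le_sum_of_subset_of_nonneg (Finset.subset_univ _) fun j _ _ =>
          mul_nonneg (hlam j) (abs_nonneg _)
    rw [hsplit]
    refine (norm_add_le _ _).trans ?_
    linarith
  have i1 : Integrable (fun ω => A * R + H ω) μ := (integrable_const _).add hHint
  have i2 : Integrable (fun ω => (1 / (m : ℝ)) * (∑ j, lam j * |φ j ω|)) μ :=
    (hwint lam Finset.univ).const_mul _
  have i12 : Integrable (fun ω => (A * R + H ω) + (1 / m) * (∑ j, lam j * |φ j ω|)) μ := i1.add i2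
  have i123 : Integrable (fun ω => (A * R + H ω) + (1 / m) * (∑ j, lam j * |φ j ω|) +
    ∑ j ∈ D, lam j * |φ j ω|) μ := i12.add (hwint lam D)
  refine ⟨_, i123.add (hwint w E), hpoint, ?_⟩
  change ∫ ω, (A * R + H ω) + (1 / m) * (∑ j, lam j * |φ j ω|) +
    ∑ j ∈ D, lam j * |φ j ω| + ∑ j ∈ E, w j * |φ j ω| ∂μ ≤ _
  rw [integral_add i123 (hwint w E), integral_add i12 (hwint lam D), integral_add i1 i2,
    integral_add (integrable_const _) hHint]
  simp only [integral_const, probReal_univ, one_smul]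
  have b1 : ∫ ω, H ω ∂μ ≤ 6 * (ε / 8) * S :=
    hHle.trans (mul_le_mul_of_nonneg_right hsum hSpos.le)
  have b2 : ∫ ω, 1 / (m : ℝ) * ∑ j, lam j * |φ j ω| ∂μ ≤ ε / 8 * S := by
    rw [integral_const_mul]
    calc _ ≤ 1 / (m : ℝ) * S :=
          mul_le_mul_of_nonneg_left (hwle lam Finset.univ hlam) (by positivity)
      _ ≤ _ := mul_le_mul_of_nonneg_right hme hSpos.le
  have b3 : ∫ ω, ∑ j ∈ D, lam j * |φ j ω| ∂μ ≤ ε / 8 * S := by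
    calc _ ≤ ∑ j ∈ D, lam j := hwle lam D hlam
      _ ≤ S / q := hDmass
      _ = 1 / q * S := by ring
      _ ≤ _ := mul_le_mul_of_nonneg_right hqe hSpos.le
  have b4 : ∫ ω, ∑ j ∈ E, w j * |φ j ω| ∂μ ≤ 1 / τ * R := by
    calc _ ≤ ∑ j ∈ E, w j := hwle w E hw0
      _ ≤ ∑ _j ∈ E, R := Finset.sum_le_sum fun j _ => hwR j
      _ = E.card * R := by simp
      _ ≤ _ := mul_le_mul_of_nonneg_right hEcard hR0
  linarith

/-! ### From the ψ₂ condition and Rademacher functions to real systems and finite averages. -/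

theorem psi2_le_psi2 {a b : ℝ} (h : |a| ≤ |b|) : psi2 a ≤ psi2 b :=
  sub_le_sub_right (Real.exp_le_exp.2 (pow_le_pow_left₀ (abs_nonneg _) h 2)) 1

/-- The strict inequality c < K avoids the question whether the Luxemburg infimum is attained; this
is why the subgaussian constant becomes |C| + 1. -/
theorem lintegral_psi2_le_one {Ω E : Type*} [MeasurableSpace Ω] [NormedAddCommGroup E]
    {μ : Measure Ω} {f : Ω → E} {c K : ℝ} (hK : 0 < K) (hcK : c < K)
    (hf : orliczNorm psi2 f μ ≤ ENNReal.ofReal c) :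
    ∫⁻ ω, ENNReal.ofReal (psi2 (‖f ω‖ / K)) ∂μ ≤ 1 := by
  have hlt : orliczNorm psi2 f μ < ENNReal.ofReal K :=
    hf.trans_lt ((ENNReal.ofReal_lt_ofReal_iff hK).2 hcK)
  simp only [orliczNorm, iInf_lt_iff] at hlt
  obtain ⟨K', hK'0, hK', hlt⟩ := hlt
  have hK'K : (K' : ℝ) < K := by
    rw [← ENNReal.ofReal_coe_nnreal] at hlt
    exact (ENNReal.ofReal_lt_ofReal_iff hK).1 hlt
  have hK'0' : (0 : ℝ) < K' := hK'0
  refine (lintegral_mono fun ω => ENNReal.ofReal_le_ofReal (psi2_le_psi2 ?_)).trans hK'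
  rw [abs_of_nonneg (by positivity), abs_of_nonneg (by positivity)]
  exact div_le_div_of_nonneg_left (norm_nonneg _) hK'0' hK'K.le

/-- Real systems dominated by a `ψ₂` system are subgaussian. -/
theorem IsSubgaussianSystem.of_psi2Condition {Ω 𝕜 ι : Type*} [MeasurableSpace Ω] [RCLike 𝕜]
    [Fintype ι] [DecidableEq ι] {μ : Measure Ω} [IsProbabilityMeasure μ] {C : ℝ}
    {φ : ι → Ω → 𝕜} (hm : ∀ j, AEStronglyMeasurable (φ j) μ) (h2 : ∀ j, eLpNorm (φ j) 2 μ = 1)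
    (hψ : Psi2Condition C φ μ) {u : ι → 𝕜} (hu : ∀ j, ‖u j‖ = 1) {f : ι → Ω → ℝ}
    (hfm : ∀ j, AEStronglyMeasurable (f j) μ)
    (hf : ∀ (a : ι → ℝ) (ω : Ω), |∑ j, a j * f j ω| ≤ ‖∑ j, ((a j : 𝕜) * u j) * φ j ω‖) :
    IsSubgaussianSystem (|C| + 1) f μ := by
  have hle : ∀ j ω, |f j ω| ≤ ‖φ j ω‖ := fun j ω => by
    have := hf (Pi.single j 1) ω
    simpa [Pi.single_apply, ite_mul, hu] using this
  have hmem : ∀ j, MemLp (φ j) 2 μ := fun j => ⟨hm j, by rw [h2 j]; exact ENNReal.one_lt_top⟩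
  have hsq : ∀ j, ∫ ω, ‖φ j ω‖ ^ 2 ∂μ = 1 := fun j => by
    have h := (hmem j).eLpNorm_eq_integral_rpow_norm two_ne_zero ENNReal.ofNat_ne_top
    rw [h2 j] at h
    simp only [ENNReal.toReal_ofNat, Real.rpow_ofNat] at h
    have h0 : 0 ≤ ∫ ω, ‖φ j ω‖ ^ 2 ∂μ := integral_nonneg fun ω => by positivity
    have h1 : (∫ ω, ‖φ j ω‖ ^ 2 ∂μ) ^ (2⁻¹ : ℝ) = 1 := by
      rw [← ENNReal.toReal_ofReal (Real.rpow_nonneg h0 _), ← h, ENNReal.toReal_one]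
    rw [← Real.rpow_inv_rpow h0 two_ne_zero, h1, Real.one_rpow]
  have hsqint : ∀ j, Integrable (fun ω => ‖φ j ω‖ ^ 2) μ := fun j =>
    (hmem j).integrable_norm_pow two_ne_zero
  have hsqle : ∀ j ω, f j ω ^ 2 ≤ ‖φ j ω‖ ^ 2 := fun j ω => by
    rw [← sq_abs]; exact pow_le_pow_left₀ (abs_nonneg _) (hle j ω) 2
  have hfsq : ∀ j, Integrable (fun ω => f j ω ^ 2) μ := fun j =>
    (hsqint j).mono' ((hfm j).pow 2) (Filter.Eventually.of_forall fun ω => by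
      rw [Real.norm_of_nonneg (sq_nonneg _)]; exact hsqle j ω)
  have hmeas : ∀ (a : ι → ℝ) (K : ℝ),
      AEStronglyMeasurable (fun ω => Real.exp (((∑ j, a j * f j ω) / K) ^ 2)) μ := fun a K => by
    refine Real.continuous_exp.comp_aestronglyMeasurable ?_
    have : AEStronglyMeasurable (fun ω => ∑ j, a j * f j ω) μ :=
      Finset.aestronglyMeasurable_fun_sum _ fun j _ => (hfm j).const_mul _
    simp only [div_eq_mul_inv]
    exact (this.mul_const _).pow 2
  have hlint : ∀ (a : ι → ℝ) (K : ℝ), 0 < K → (|C| + 1) * √(∑ j, a j ^ 2) ≤ K →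
      ∫⁻ ω, ENNReal.ofReal (Real.exp (((∑ j, a j * f j ω) / K) ^ 2)) ∂μ ≤ 2 := by
    intro a K hK hCK
    have hnorm : ∀ j, ‖(a j : 𝕜) * u j‖ ^ 2 = a j ^ 2 := fun j => by
      rw [norm_mul, hu, mul_one, RCLike.norm_ofReal, sq_abs]
    have hcK : C * √(∑ j, a j ^ 2) < K := by
      rcases (Real.sqrt_nonneg (∑ j, a j ^ 2)).eq_or_lt with h | h
      · rw [← h, mul_zero]; exact hK
      · nlinarith [le_abs_self C]
    have h := hψ fun j => (a j : 𝕜) * u j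
    simp only [hnorm] at h
    have h1 := lintegral_psi2_le_one hK hcK h
    calc _ ≤ ∫⁻ ω, (ENNReal.ofReal (psi2 (‖∑ j, ((a j : 𝕜) * u j) * φ j ω‖ / K)) + 1) ∂μ := by
          refine lintegral_mono fun ω => ?_
          have hp : 0 ≤ psi2 (‖∑ j, ((a j : 𝕜) * u j) * φ j ω‖ / K) :=
            sub_nonneg.2 (Real.one_le_exp (by positivity))
          rw [← ENNReal.ofReal_one, ← ENNReal.ofReal_add hp zero_le_one]
          refine ENNReal.ofReal_le_ofReal ?_
          rw [psi2, sub_add_cancel]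
          refine Real.exp_le_exp.2 ?_
          rw [← sq_abs]
          refine pow_le_pow_left₀ (abs_nonneg _) ?_ 2
          rw [abs_div, abs_div, abs_norm]
          exact div_le_div_of_nonneg_right (hf a ω) (abs_nonneg _)
      _ = ∫⁻ ω, ENNReal.ofReal (psi2 (‖∑ j, ((a j : 𝕜) * u j) * φ j ω‖ / K)) ∂μ + 1 := by
          rw [lintegral_add_right _ measurable_const]; simp
      _ ≤ 1 + 1 := by gcongr
      _ = 2 := one_add_one_eq_two
  refine ⟨hfm, hfsq, fun j => ?_, fun a K hK hCK => ?_, fun a K hK hCK => ?_⟩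
  · exact (integral_mono (hfsq j) (hsqint j) (hsqle j)).trans (hsq j).le
  · refine ⟨hmeas a K, ?_⟩
    rw [hasFiniteIntegral_iff_ofReal (Filter.Eventually.of_forall fun ω => (Real.exp_pos _).le)]
    exact (hlint a K hK hCK).trans_lt ENNReal.ofNat_lt_top
  · rw [integral_eq_lintegral_of_nonneg_ae
      (Filter.Eventually.of_forall fun ω => (Real.exp_pos _).le) (hmeas a K)]
    exact ENNReal.toReal_le_of_le_ofReal (by norm_num) (by simpa using hlint a K hK hCK)

/-- Expectations over a Rademacher system are averages over all signs. -/
theorem IsRademacherSystem.integral_eq {Ω ι : Type*} [MeasurableSpace Ω] [Fintype ι]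
    [DecidableEq ι] {P : Measure Ω} [IsProbabilityMeasure P] {r : ι → Ω → ℝ}
    (hr : IsRademacherSystem r P) (F : (ι → ℝ) → ℝ) :
    ∫ ω, F (fun j => r j ω) ∂P = 𝔼 ε : ι → Bool, F fun j => boolSign (ε j) := by
  -- These sign patterns partition the space up to a null set into events of probability 2⁻ⁿ, n =
  -- card ι. The integrand is a.e. constant on each, so F needs no measurability.
  set E : (ι → Bool) → Set Ω := fun ε => ⋂ j ∈ Finset.univ, r j ⁻¹' {boolSign (ε j)} with hE
  have hEmem : ∀ ε ω, ω ∈ E ε ↔ ∀ j, r j ω = boolSign (ε j) := fun ε ω => by simp [hE]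
  have hEmeas : ∀ ε, MeasurableSet (E ε) := fun ε =>
    Finset.measurableSet_biInter _ fun j _ => hr.measurable j (measurableSet_singleton _)
  have hhalf : ∀ j b, P (r j ⁻¹' {boolSign b}) = 2⁻¹ := fun j b => by
    cases b
    · simpa [boolSign, Set.preimage] using hr.prob_neg_one j
    · simpa [boolSign, Set.preimage] using hr.prob_one j
  have hPE : ∀ ε, P.real (E ε) = (2⁻¹ : ℝ) ^ Fintype.card ι := fun ε => by
    rw [measureReal_def, hr.indep.measure_inter_preimage_eq_mul Finset.univ
      fun j _ => measurableSet_singleton _]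
    simp [hhalf]
  have hboolSign : Function.Injective boolSign := fun a b h => by
    revert h; cases a <;> cases b <;> norm_num [boolSign]
  have hae : ∀ᵐ ω ∂P, ∀ j, ∃ b, r j ω = boolSign b := by
    rw [ae_all_iff]
    intro j
    have hd : Disjoint (r j ⁻¹' {boolSign true}) (r j ⁻¹' {boolSign false}) := by
      refine Disjoint.preimage _ (Set.disjoint_singleton.2 fun h => ?_)
      exact absurd (hboolSign h) (by simp)
    have hm : ∀ b, MeasurableSet (r j ⁻¹' {boolSign b}) := fun b =>
      hr.measurable j (measurableSet_singleton _)
    have h1 : P (r j ⁻¹' {boolSign true} ∪ r j ⁻¹' {boolSign false}) = 1 := by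
      rw [measure_union hd (hm _), hhalf, hhalf, ENNReal.inv_two_add_inv_two]
    have h2 := (prob_compl_eq_zero_iff ((hm true).union (hm false))).2 h1
    refine measure_mono_null (fun ω hω => ?_) h2
    intro hω'
    refine hω ?_
    rcases hω' with h | h
    · exact ⟨true, h⟩
    · exact ⟨false, h⟩
  have hsum : ∀ᵐ ω ∂P, F (fun j => r j ω) =
      ∑ ε, (E ε).indicator (fun _ => F fun j => boolSign (ε j)) ω := by
    filter_upwards [hae] with ω hω
    choose b hb using hω
    rw [Finset.sum_eq_single b]
    · rw [Set.indicator_of_mem ((hEmem b ω).2 hb)]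
      congr 1
      exact funext hb
    · intro ε _ hne
      refine Set.indicator_of_notMem (fun h => hne ?_) _
      exact funext fun j => hboolSign (((hEmem ε ω).1 h j).symm.trans (hb j))
    · simp
  rw [integral_congr_ae hsum, integral_finsetSum _ fun ε _ =>
    (integrable_const _).indicator (hEmeas ε)]
  simp only [integral_indicator_const _ (hEmeas _), hPE, smul_eq_mul]
  rw [Finset.expect_eq_sum_div_card, ← Finset.mul_sum]
  simp [div_eq_inv_mul]

/-! ### Conclusion. -/

theorem mainTheorem3 (C β : ℝ) (hβ : 0 < β) :
    ∃ γ : ℝ, 0 < γ ∧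
      ∀ (𝕜 : Type*) [RCLike 𝕜]
        (Ω : Type*) [MeasurableSpace Ω] (μ : Measure Ω) [IsProbabilityMeasure μ]
        (Ω' : Type*) [MeasurableSpace Ω'] (P : Measure Ω') [IsProbabilityMeasure P]
        (X : Type*) [NormedAddCommGroup X] [NormedSpace 𝕜 X]
        (n : ℕ) (φ : Fin n → Ω → 𝕜) (r : Fin n → Ω' → ℝ) (x : Fin n → X) (lam : Fin n → 𝕜),
        (∀ j, AEStronglyMeasurable (φ j) μ) →
        (∀ j, eLpNorm (φ j) 2 μ = 1) →
        Psi2Condition C φ μ →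
        IsRademacherSystem r P →
        (∀ j, ‖x j‖ ≤ 1) →
        β * ∑ j, ‖lam j‖ ≤ ∫ ω, ‖∑ j, (((‖lam j‖ : ℝ) : 𝕜) * φ j ω) • x j‖ ∂μ →
        γ * ∑ j, ‖lam j‖ ≤ ∫ ω, ‖∑ j, (lam j * ((r j ω : ℝ) : 𝕜)) • x j‖ ∂P := by
  obtain ⟨A, hA, hmain⟩ := exists_majorant_norm (C := |C| + 1) (ε := β / 4) (by positivity)
    (by positivity)
  -- The real and imaginary parts together give βS ≤ 2AR + (β/2)S, with S = ∑ ‖lam j‖ and R the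
  -- Rademacher average.
  refine ⟨β / (4 * A), by positivity, ?_⟩
  intro 𝕜 _ Ω _ μ _ Ω' _ P _ X _ _ n φ r x lam hφm hφ2 hψ hr hx hint
  let _ : NormedSpace ℝ X := NormedSpace.restrictScalars ℝ 𝕜 X
  have hsmul : ∀ (c : ℝ) (v : X), c • v = (c : 𝕜) • v := fun c v => rfl
  -- the phases of the coefficients
  obtain ⟨u, hu1, hulam⟩ : ∃ u : Fin n → 𝕜, (∀ j, ‖u j‖ = 1) ∧
      ∀ j, ((‖lam j‖ : ℝ) : 𝕜) * u j = lam j := by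
    have : ∀ z : 𝕜, ∃ w : 𝕜, ‖w‖ = 1 ∧ ((‖z‖ : ℝ) : 𝕜) * w = z := fun z => by
      by_cases hz : z = 0
      · exact ⟨1, by simp, by simp [hz]⟩
      · have hz' : ((‖z‖ : ℝ) : 𝕜) ≠ 0 := by simpa using hz
        refine ⟨z / ((‖z‖ : ℝ) : 𝕜), ?_, mul_div_cancel₀ _ hz'⟩
        rw [norm_div, RCLike.norm_ofReal, abs_norm, div_self (by simpa using hz)]
    choose w hw using this
    exact ⟨fun j => w (lam j), fun j => (hw _).1, fun j => (hw _).2⟩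
  have hu0 : ∀ j, u j ≠ 0 := fun j => norm_ne_zero_iff.1 (by rw [hu1 j]; exact one_ne_zero)
  -- The phases move into the vectors and, inverted, into the functions, so both averages are
  -- expressed with the weights ‖lam j‖ and the same vectors y.
  set y : Fin n → X := fun j => u j • x j with hy
  have hy1 : ∀ j, ‖y j‖ ≤ 1 := fun j => by simpa [hy, norm_smul, hu1] using hx j
  set ψ : Fin n → Ω → 𝕜 := fun j ω => (u j)⁻¹ * φ j ω with hψdef
  have hψm : ∀ j, AEStronglyMeasurable (ψ j) μ := fun j => (hφm j).const_mul _
  have hui : ∀ j, ‖(u j)⁻¹‖ = 1 := fun j => by rw [norm_inv, hu1, inv_one]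
  have hcomb : ∀ (a : Fin n → ℝ) (ω : Ω),
      ∑ j, ((a j : 𝕜) * (u j)⁻¹) * φ j ω = ∑ j, (a j : 𝕜) * ψ j ω := fun a ω =>
    Finset.sum_congr rfl fun j _ => mul_assoc _ _ _
  have hre : IsSubgaussianSystem (|C| + 1) (fun j ω => RCLike.re (ψ j ω)) μ := by
    refine .of_psi2Condition hφm hφ2 hψ hui
      (fun j => RCLike.continuous_re.comp_aestronglyMeasurable (hψm j)) fun a ω => ?_
    have e : ∑ j, a j * RCLike.re (ψ j ω) = RCLike.re (∑ j, (a j : 𝕜) * ψ j ω) := by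
      simp [map_sum]
    rw [hcomb, e]
    exact RCLike.abs_re_le_norm _
  have him : IsSubgaussianSystem (|C| + 1) (fun j ω => RCLike.im (ψ j ω)) μ := by
    refine .of_psi2Condition hφm hφ2 hψ hui
      (fun j => RCLike.continuous_im.comp_aestronglyMeasurable (hψm j)) fun a ω => ?_
    have e : ∑ j, a j * RCLike.im (ψ j ω) = RCLike.im (∑ j, (a j : 𝕜) * ψ j ω) := by
      simp [map_sum]
    rw [hcomb, e]
    exact RCLike.abs_im_le_norm _
  obtain ⟨G₁, hG₁, hG₁le, hG₁int⟩ := hmain (Fin n) Ω X μ _ y (fun j => ‖lam j‖) hre hy1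
    fun j => norm_nonneg _
  obtain ⟨G₂, hG₂, hG₂le, hG₂int⟩ := hmain (Fin n) Ω X μ _ y (fun j => ‖lam j‖) him hy1
    fun j => norm_nonneg _
  have hpoint : ∀ ω, ‖∑ j, (((‖lam j‖ : ℝ) : 𝕜) * φ j ω) • x j‖ ≤ G₁ ω + G₂ ω := fun ω => by
    have e : ∑ j, (((‖lam j‖ : ℝ) : 𝕜) * φ j ω) • x j =
        ∑ j, (‖lam j‖ * RCLike.re (ψ j ω)) • y j +
          (RCLike.I : 𝕜) • ∑ j, (‖lam j‖ * RCLike.im (ψ j ω)) • y j := by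
      rw [Finset.smul_sum, ← Finset.sum_add_distrib]
      refine Finset.sum_congr rfl fun j _ => ?_
      simp only [hy, hsmul, smul_smul, ← add_smul]
      congr 1
      have h1 : φ j ω = u j * ψ j ω := by
        simp only [hψdef]; rw [mul_inv_cancel_left₀ (hu0 j)]
      rw [h1]
      conv_lhs => rw [← RCLike.re_add_im (ψ j ω)]
      push_cast
      ring
    rw [e]
    refine (norm_add_le _ _).trans (add_le_add (hG₁le ω) ?_)
    have hI : ‖(RCLike.I : 𝕜)‖ ≤ 1 := by
      rcases RCLike.I_mul_I_ax (K := 𝕜) with h | h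
      · simp [h]
      · exact (RCLike.norm_I_of_ne_zero fun h0 => by simp [h0] at h).le
    rw [norm_smul]
    exact (mul_le_of_le_one_left (norm_nonneg _) hI).trans (hG₂le ω)
  have hR : ∫ ω, ‖∑ j, (lam j * ((r j ω : ℝ) : 𝕜)) • x j‖ ∂P =
      𝔼 σ : Fin n → Bool, ‖∑ j, (‖lam j‖ * boolSign (σ j)) • y j‖ := by
    rw [hr.integral_eq fun ρ => ‖∑ j, (lam j * ((ρ j : ℝ) : 𝕜)) • x j‖]
    refine Finset.expect_congr rfl fun σ _ => ?_
    congr 1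
    refine Finset.sum_congr rfl fun j _ => ?_
    rw [hsmul, hy, smul_smul]
    congr 1
    conv_lhs => rw [← hulam j]
    push_cast
    ring
  have hle : ∫ ω, ‖∑ j, (((‖lam j‖ : ℝ) : 𝕜) * φ j ω) • x j‖ ∂μ ≤ ∫ ω, G₁ ω ∂μ + ∫ ω, G₂ ω ∂μ := by
    rw [← integral_add hG₁ hG₂]
    exact integral_mono_of_nonneg (Filter.Eventually.of_forall fun ω => norm_nonneg _)
      (hG₁.add hG₂) (Filter.Eventually.of_forall hpoint)
  rw [← hR] at hG₁int hG₂int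
  rw [div_mul_eq_mul_div, div_le_iff₀ (by positivity)]
  linarith
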